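/- Let $d,r,q,k,\Delta\ge 0$ be integers with $d<r$, $r=q(d+1)+k$ and $0\le k\le d$ (so $q=\lfloor r/(d+1)\rfloor\ge 1$). Let $G$ be a finite $r$-partite graph with parts $V_1,\dots,V_r$ (so the $V_i$ partition the vertex set and every edge joins two different parts), with maximum degree at most $\Delta$, such that for every $i$ \[|V_i|>\max\left\{2\Delta\left(1-\frac{4d+5}{4r}\right),\ 2\Delta\left(1-\frac1q\right)\right\}.\] Then $G$ has an independent $(r-d)$-transversal, that is, an independent set of $r-d$ vertices lying in $r-d$ different parts. In other words, let $n(r,D,\Delta)$ be the largest integer $n\ge 0$ for which there is a finite $r$-partite graph with at least $n$ vertices in each part, maximum degree exactly $\Delta$, and no independent $(r-D+1)$-transversal (and $n(r,D,\Delta)=0$ if there is no such $n$). Then the set of $n$ with this property for $D=d+1$ is bounded above, and \[n(r,d+1,\Delta)\le\max\left\{2\Delta\left(1-\frac{4d+5}{4r}\right),\ 2\Delta\left(1-\frac1q\right)\right\}.\] -/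

import Mathlib

/-- An `r`-partite graph is a graph `G` with a proper colouring `c : G.Coloring (Fin r)`; its parts
`V₁, …, V_r` are the colour classes `c.colorClass i`. An independent `t`-transversal is an
independent set of `t` vertices that lie in `t` different parts. -/
def IsIndepTransversal {V : Type*} {G : SimpleGraph V} {r : ℕ} (c : G.Coloring (Fin r))
    (t : ℕ) (T : Finset V) : Prop :=
  G.IsIndepSet (T : Set V) ∧ Set.InjOn c (T : Set V) ∧ T.card = t

/-- The set of all `n` for which there is a finite `r`-partite graph with at least `n` vertices in
each part, maximum degree exactly `Δ`, and no independent `(r - D + 1)`-transversal. -/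
def avoidingSizes (r D Δ : ℕ) : Set ℕ :=
  {n | ∃ (V : Type) (_ : Fintype V) (G : SimpleGraph V) (_ : DecidableRel G.Adj)
      (c : G.Coloring (Fin r)),
      (∀ i : Fin r, n ≤ (c.colorClass i).ncard) ∧ G.maxDegree = Δ ∧
      ¬ ∃ T : Finset V, IsIndepTransversal c (r + 1 - D) T}

/-- The extremal function `n(r, D, Δ)`: the largest element of `avoidingSizes r D Δ`
(`0` if there is none). -/
noncomputable def extremalSize (r D Δ : ℕ) : ℕ := sSup (avoidingSizes r D Δ)

/-- The bound `max {2Δ(1 - (4d+5)/(4r)), 2Δ(1 - 1/q)}`, for `r, q ≥ 1`. -/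
noncomputable def sizeBound (r d q Δ : ℕ) : ℝ :=
  max (2 * (Δ : ℝ) * (1 - (4 * (d : ℝ) + 5) / (4 * (r : ℝ))))
    (2 * (Δ : ℝ) * (1 - 1 / (q : ℝ)))

/-! Suppose every independent partial transversal misses at least `d + 1` parts. Let `X` dominate
all vertices in a nonempty set `K` of parts. The first term of the size bound gives `4 * |K| < 2 *
|X| + 4 * d + 5`, so `2 * |K| ≤ |X| + 2 * d + 2` (`two_mul_card_le_of_dominates`). Haxell's argument
produces dominating sets about this small, and the proof exploits how little room remains.

A largest partial transversal misses exactly `d + 1` parts. Taken as `d + 1` one-part trees, these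
are grown into a forest of induced matchings: each edge of the matching joins two parts, each tree
spans its set of parts, and the remaining parts keep an independent transversal avoiding the
neighbours of the forest. A tree has an independent transversal missing any prescribed part of it.
If some vertex in the parts of the forest is undominated by it, minimality and counting show that
this vertex meets a suitable transversal of the rest in exactly one vertex, and this edge enlarges
the forest (`IsExtendableForest.exists_larger`). Hence a maximal forest dominates all its own parts.

Domination is then almost tight, so each forest vertex has more than `Δ / 2` private neighbours
(`IsForest.lt_two_mul_card_privateNeighbors`). Each of these may replace the partner of that vertex
without changing the parts of any tree (`IsForest.exists_switch`).

Some tree `a` has at most `q` parts, and the second term of the bound gives a vertex `v` in them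
that tree `a` does not dominate. Keep tree `a` and switch elsewhere until `v` has as few neighbours
in the forest as possible. Then for every forest neighbour `x` of `v`, all private neighbours of the
partner of `x` are adjacent to `v`. Two such `x` would give `v` more than `Δ` neighbours. A single
one makes `v` a private neighbour of `x`, which forces `v` into the parts of the tree of `x`, a tree
other than `a`. -/

/-- Some vertex of `D` is adjacent to `v`. -/
def Dominates {V : Type*} (G : SimpleGraph V) (D : Finset V) (v : V) : Prop :=
  ∃ x ∈ D, G.Adj x v

/-- There is no edge between `S` and `T`. -/
def Nonadj {V : Type*} (G : SimpleGraph V) (S T : Finset V) : Prop :=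
  ∀ x ∈ S, ∀ y ∈ T, ¬ G.Adj x y

/-- `S` is an independent set with exactly one vertex in each part of `P`, and no others. -/
structure IsTransversalOn {V ι : Type*} [DecidableEq ι] (G : SimpleGraph V) (c : V → ι)
    (P : Finset ι) (S : Finset V) : Prop where
  image_eq : S.image c = P
  injOn : Set.InjOn c (S : Set V)
  indep : Nonadj G S S

/-- No vertex in the parts `J` that is not dominated by `D` can be completed by an independent
transversal of the parts `Q` that avoids the neighbours of `D`. -/
def Blocked {V ι : Type*} [DecidableEq V] [DecidableEq ι] (G : SimpleGraph V) (c : V → ι)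
    (J : Finset ι) (D : Finset V) (Q : Finset ι) : Prop :=
  ∀ u Y, c u ∈ J → ¬ Dominates G D u → IsTransversalOn G c Q Y → ¬ Nonadj G (insert u D) Y

/-! ### Haxell's domination argument for independent transversals -/

section Haxell

set_option linter.unusedSectionVars false

variable {V ι : Type*} [DecidableEq V] [DecidableEq ι] {G : SimpleGraph V} {c : V → ι}

theorem Nonadj.symm {S T : Finset V} (h : Nonadj G S T) : Nonadj G T S :=
  fun x hx y hy hxy => h y hy x hx hxy.symm

theorem Nonadj.mono {S S' T T' : Finset V} (h : Nonadj G S T) (hS : S' ⊆ S) (hT : T' ⊆ T) :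
    Nonadj G S' T' :=
  fun x hx y hy => h x (hS hx) y (hT hy)

theorem Nonadj.union_left {S S' T : Finset V} (h : Nonadj G S T) (h' : Nonadj G S' T) :
    Nonadj G (S ∪ S') T := by
  intro x hx y hy
  rcases Finset.mem_union.1 hx with hx | hx
  exacts [h x hx y hy, h' x hx y hy]

theorem Nonadj.union_right {S T T' : Finset V} (h : Nonadj G S T) (h' : Nonadj G S T') :
    Nonadj G S (T ∪ T') :=
  (h.symm.union_left h'.symm).symm

theorem Nonadj.insert_left {S T : Finset V} {u : V} (h : Nonadj G S T)
    (hu : ¬ Dominates G T u) : Nonadj G (insert u S) T := by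
  intro x hx y hy hxy
  rcases Finset.mem_insert.1 hx with rfl | hx
  exacts [hu ⟨y, hy, hxy.symm⟩, h x hx y hy hxy]

theorem Nonadj.insert_right {S T : Finset V} {u : V} (h : Nonadj G S T)
    (hu : ¬ Dominates G S u) : Nonadj G S (insert u T) :=
  (h.symm.insert_left hu).symm

theorem Nonadj.not_dominates {S T : Finset V} (h : Nonadj G S T) {u : V} (hu : u ∈ T) :
    ¬ Dominates G S u := by
  rintro ⟨x, hx, hxu⟩
  exact h x hx u hu hxu

theorem Dominates.mono {S T : Finset V} {v : V} (h : Dominates G S v) (hST : S ⊆ T) :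
    Dominates G T v := by
  obtain ⟨x, hx, hxv⟩ := h
  exact ⟨x, hST hx, hxv⟩

theorem IsTransversalOn.sdiff {P : Finset ι} {S E : Finset V} (h : IsTransversalOn G c P S)
    (hE : E ⊆ S) : IsTransversalOn G c (P \ E.image c) (S \ E) where
  image_eq := by
    ext i
    simp only [Finset.mem_image, Finset.mem_sdiff, ← h.image_eq]
    constructor
    · rintro ⟨x, ⟨hx, hxE⟩, rfl⟩
      refine ⟨⟨x, hx, rfl⟩, ?_⟩
      rintro ⟨y, hy, hyx⟩
      exact hxE (h.injOn (hE hy) hx hyx ▸ hy)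
    · rintro ⟨⟨x, hx, rfl⟩, hn⟩
      exact ⟨x, ⟨hx, fun hxE => hn ⟨x, hxE, rfl⟩⟩, rfl⟩
  injOn := h.injOn.mono (by simp)
  indep := h.indep.mono Finset.sdiff_subset Finset.sdiff_subset

theorem IsTransversalOn.subset {P : Finset ι} {S E : Finset V} (h : IsTransversalOn G c P S)
    (hE : E ⊆ S) : IsTransversalOn G c (E.image c) E where
  image_eq := rfl
  injOn := h.injOn.mono (by simpa using hE)
  indep := h.indep.mono hE hE

theorem IsTransversalOn.mem {P : Finset ι} {S : Finset V} (h : IsTransversalOn G c P S) {x : V}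
    (hx : x ∈ S) : c x ∈ P :=
  h.image_eq ▸ Finset.mem_image_of_mem c hx

theorem IsTransversalOn.card_eq {P : Finset ι} {S : Finset V} (h : IsTransversalOn G c P S) :
    S.card = P.card := by
  rw [← h.image_eq, Finset.card_image_of_injOn h.injOn]

theorem injOn_union_of_disjoint {S T : Finset V} {P Q : Finset ι} (hS : Set.InjOn c (S : Set V))
    (hT : Set.InjOn c (T : Set V)) (hSP : ∀ x ∈ S, c x ∈ P) (hTQ : ∀ x ∈ T, c x ∈ Q)
    (hPQ : Disjoint P Q) : Set.InjOn c ((S ∪ T : Finset V) : Set V) := by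
  intro x hx y hy hxy
  rcases Finset.mem_union.1 (Finset.mem_coe.1 hx) with hx | hx <;>
    rcases Finset.mem_union.1 (Finset.mem_coe.1 hy) with hy | hy
  · exact hS hx hy hxy
  · exact (Finset.disjoint_left.1 hPQ (hSP x hx) (hxy ▸ hTQ y hy)).elim
  · exact (Finset.disjoint_left.1 hPQ (hSP y hy) (hxy ▸ hTQ x hx)).elim
  · exact hT hx hy hxy

theorem IsTransversalOn.union {P Q : Finset ι} {S T : Finset V} (hS : IsTransversalOn G c P S)
    (hT : IsTransversalOn G c Q T) (hPQ : Disjoint P Q) (hST : Nonadj G S T) :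
    IsTransversalOn G c (P ∪ Q) (S ∪ T) where
  image_eq := by rw [Finset.image_union, hS.image_eq, hT.image_eq]
  injOn := injOn_union_of_disjoint hS.injOn hT.injOn (fun _ => hS.mem) (fun _ => hT.mem) hPQ
  indep := (hS.indep.union_left hST.symm).union_right (hST.union_left hT.indep)

theorem isTransversalOn_singleton (w : V) : IsTransversalOn G c {c w} {w} where
  image_eq := by simp
  injOn := by simp
  indep := by
    intro x hx y hy
    rw [Finset.mem_singleton.1 hx, Finset.mem_singleton.1 hy]
    exact G.irrefl

theorem IsTransversalOn.replace {P : Finset ι} {S : Finset V} (h : IsTransversalOn G c P S)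
    {e w : V} (he : e ∈ S) (hw : c w = c e) (hwS : ¬ Dominates G S w) :
    IsTransversalOn G c P (insert w (S.erase e)) := by
  have h1 := h.sdiff (Finset.singleton_subset_iff.2 he)
  rw [Finset.sdiff_singleton_eq_erase] at h1
  have h2 := (isTransversalOn_singleton (G := G) (c := c) w).union h1
    (by simp [hw]) (by
      intro x hx y hy hxy
      rw [Finset.mem_singleton.1 hx] at hxy
      exact hwS ⟨y, Finset.mem_of_mem_erase hy, hxy.symm⟩)
  have h3 : ({c w} ∪ P \ ({e} : Finset V).image c : Finset ι) = P := by
    rw [Finset.image_singleton, hw]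
    exact Finset.union_sdiff_of_subset (Finset.singleton_subset_iff.2 (h.mem he))
  rw [h3] at h2
  rwa [Finset.insert_eq]

variable [DecidableRel G.Adj]

/-- One round of Haxell's argument. A vertex `w` violating the new blocking either lies in `J`,
where `Y1` together with the removed neighbours of `u` violates the old one, or lies in the part of
some removed `e`, where exchanging `e` for `w` contradicts the minimality of `Y`. -/
theorem Blocked.step {J Q : Finset ι} {D Y : Finset V} {u : V} (hB : Blocked G c J D Q)
    (huJ : c u ∈ J) (hu : ¬ Dominates G D u) (hY : IsTransversalOn G c Q Y)
    (hDY : Nonadj G D Y)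
    (hmin : ∀ Y', IsTransversalOn G c Q Y' → Nonadj G D Y' →
      (Y.filter (G.Adj u)).card ≤ (Y'.filter (G.Adj u)).card) :
    (Y.filter (G.Adj u)).Nonempty ∧
    Blocked G c (J ∪ (Y.filter (G.Adj u)).image c) (insert u (D ∪ Y.filter (G.Adj u)))
      (Q \ (Y.filter (G.Adj u)).image c) ∧
    IsTransversalOn G c (Q \ (Y.filter (G.Adj u)).image c) (Y \ Y.filter (G.Adj u)) ∧
    Nonadj G (insert u (D ∪ Y.filter (G.Adj u))) (Y \ Y.filter (G.Adj u)) := by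
  set E := Y.filter (G.Adj u) with hE
  have hEY : E ⊆ Y := Finset.filter_subset _ _
  have hPE : E.image c ⊆ Q := hY.image_eq ▸ Finset.image_subset_image hEY
  refine ⟨?_, ?_, hY.sdiff hEY, ?_⟩
  · rw [Finset.nonempty_iff_ne_empty]
    intro h0
    refine hB u Y huJ hu hY (hDY.insert_left ?_)
    rintro ⟨y, hy, hyu⟩
    have : y ∈ E := Finset.mem_filter.2 ⟨hy, hyu.symm⟩
    simp [h0] at this
  · intro w Y1 hw hwD hY1 hn
    have hDY1 : Nonadj G D Y1 := hn.mono (by intro x; simp +contextual) subset_rfl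
    have hEY1 : Nonadj G E Y1 := hn.mono (by intro x; simp +contextual) subset_rfl
    have hwE : ¬ Dominates G E w := fun h => hwD (h.mono (by intro x; simp +contextual))
    have hwD' : ¬ Dominates G D w := fun h => hwD (h.mono (by intro x; simp +contextual))
    have hwY1 : ¬ Dominates G Y1 w := by
      rintro ⟨y, hy, hyw⟩
      exact hn w (by simp) y hy hyw.symm
    rcases Finset.mem_union.1 hw with hw | hw
    · have h1 := hY1.union (hY.subset hEY) Finset.sdiff_disjoint hEY1.symm
      rw [Finset.sdiff_union_of_subset hPE] at h1
      refine hB w _ hw hwD' h1 (Nonadj.insert_left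
        (hDY1.union_right (hDY.mono subset_rfl hEY)) ?_)
      rintro ⟨y, hy, hyw⟩
      rcases Finset.mem_union.1 hy with hy | hy
      exacts [hwY1 ⟨y, hy, hyw⟩, hwE ⟨y, hy, hyw⟩]
    · obtain ⟨e, he, hew⟩ := Finset.mem_image.1 hw
      have h2 := (hY.subset hEY).replace he hew.symm hwE
      have h1 := hY1.union h2 Finset.sdiff_disjoint
        ((hEY1.symm.mono subset_rfl (Finset.erase_subset _ _)).insert_right hwY1)
      rw [Finset.sdiff_union_of_subset hPE] at h1
      have h3 := hmin _ h1 (hDY1.union_right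
        ((hDY.mono subset_rfl ((Finset.erase_subset _ _).trans hEY)).insert_right hwD'))
      -- Neither `Y1` nor `w` contributes a neighbour of `u`, since `u` now belongs to the
      -- dominating set both avoid.
      have h4 : ((Y1 ∪ insert w (E.erase e)).filter (G.Adj u)) ⊆ E.erase e := by
        intro x hx
        obtain ⟨hx, hux⟩ := Finset.mem_filter.1 hx
        rcases Finset.mem_union.1 hx with hx | hx
        · exact (hn u (by simp) x hx hux).elim
        · rcases Finset.mem_insert.1 hx with rfl | hx
          · exact (hwD ⟨u, by simp, hux⟩).elim
          · exact hx
      have h5 := Finset.card_le_card h4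
      have h6 := Finset.card_erase_lt_of_mem he
      omega
  · refine Nonadj.insert_left (Nonadj.union_left (hDY.mono subset_rfl Finset.sdiff_subset)
      (hY.indep.mono hEY Finset.sdiff_subset)) ?_
    rintro ⟨y, hy, hyu⟩
    obtain ⟨hy, hyE⟩ := Finset.mem_sdiff.1 hy
    exact hyE (Finset.mem_filter.2 ⟨hy, hyu.symm⟩)

theorem exists_transversal_minimizing {Q : Finset ι} {D : Finset V} (u : V)
    (h : ∃ Y, IsTransversalOn G c Q Y ∧ Nonadj G D Y) :
    ∃ Y, IsTransversalOn G c Q Y ∧ Nonadj G D Y ∧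
      ∀ Y', IsTransversalOn G c Q Y' → Nonadj G D Y' →
        (Y.filter (G.Adj u)).card ≤ (Y'.filter (G.Adj u)).card := by
  obtain ⟨Y, ⟨hY, hDY⟩, hmin⟩ := exists_minimalFor_of_wellFoundedLT
    (fun Y => IsTransversalOn G c Q Y ∧ Nonadj G D Y) (fun Y => (Y.filter (G.Adj u)).card) h
  refine ⟨Y, hY, hDY, fun Y' h1 h2 => ?_⟩
  rcases le_total (Y.filter (G.Adj u)).card (Y'.filter (G.Adj u)).card with h | h
  exacts [h, hmin ⟨h1, h2⟩ h]

/-- Haxell's domination argument. -/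
theorem Blocked.exists_dominating {J Q : Finset ι} {D : Finset V} (hB : Blocked G c J D Q)
    (hY : ∃ Y, IsTransversalOn G c Q Y ∧ Nonadj G D Y) :
    ∃ S ⊆ Q, ∃ D' : Finset V, D'.card ≤ 2 * S.card ∧
      ∀ v, c v ∈ J ∪ S → Dominates G (D ∪ D') v := by
  induction hn : Q.card using Nat.strong_induction_on generalizing J Q D with
  | _ n ih =>
  subst hn
  by_cases hdom : ∀ v, c v ∈ J → Dominates G D v
  · exact ⟨∅, by simp, ∅, by simp, by simpa using hdom⟩
  push Not at hdom
  obtain ⟨u, huJ, hu⟩ := hdom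
  obtain ⟨Y, hY, hDY, hmin⟩ := exists_transversal_minimizing u hY
  obtain ⟨hE, hB', hY', hDY'⟩ := hB.step huJ hu hY hDY hmin
  set E := Y.filter (G.Adj u)
  have hEY : E ⊆ Y := Finset.filter_subset _ _
  have hPE : E.image c ⊆ Q := hY.image_eq ▸ Finset.image_subset_image hEY
  have hcard : (E.image c).card = E.card := Finset.card_image_of_injOn (hY.subset hEY).injOn
  have hpos : 0 < E.card := hE.card_pos
  obtain ⟨S, hS, D', hD', hdom⟩ := ih _ (by
    have := Finset.card_sdiff_add_card_eq_card hPE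
    omega) hB' ⟨_, hY', hDY'⟩ rfl
  -- The round adds `|E|` parts at a cost of `|E| + 1 ≤ 2 * |E|` vertices, because `E` is nonempty.
  refine ⟨E.image c ∪ S, Finset.union_subset hPE (hS.trans Finset.sdiff_subset),
    insert u (E ∪ D'), ?_, ?_⟩
  · have h1 : (E.image c ∪ S).card = (E.image c).card + S.card :=
      Finset.card_union_of_disjoint (Finset.disjoint_of_subset_right hS Finset.disjoint_sdiff)
    have h2 := Finset.card_insert_le u (E ∪ D')
    have h3 := Finset.card_union_le E D'
    omega
  · intro v hv
    refine (hdom v (by rwa [Finset.union_assoc])).mono ?_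
    intro x
    simp only [Finset.mem_union, Finset.mem_insert]
    tauto

/-- Either the parts `Q` have an independent transversal that avoids the neighbours of `R`, or some
of them are dominated by `R` together with few further vertices. -/
theorem exists_transversal_or_dominating (R : Finset V) (Q : Finset ι) :
    (∃ Y, IsTransversalOn G c Q Y ∧ Nonadj G R Y) ∨
    ∃ K ⊆ Q, ∃ D' : Finset V, D'.card + 2 ≤ 2 * K.card ∧
      ∀ v, c v ∈ K → Dominates G (R ∪ D') v := by
  induction Q using Finset.induction_on with
  | empty =>
    left
    exact ⟨∅, ⟨by simp, by simp, by simp [Nonadj]⟩, by simp [Nonadj]⟩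
  | insert i Q hi ih =>
    rcases ih with hY | ⟨K, hK, h⟩
    · by_cases hB : Blocked G c {i} R Q
      · right
        obtain ⟨S, hS, D', hD', hdom⟩ := hB.exists_dominating hY
        -- The part `i` costs no vertices of its own; this is the saving of 2 in the conclusion.
        refine ⟨{i} ∪ S, ?_, D', ?_, hdom⟩
        · rw [← Finset.insert_eq]
          exact Finset.insert_subset_insert i hS
        · rw [Finset.card_union_of_disjoint (by simpa using fun h => hi (hS h))]
          simp
          omega
      · left
        unfold Blocked at hB
        push Not at hB
        obtain ⟨u, Y, hu, huR, hY, hn⟩ := hB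
        rw [Finset.mem_singleton] at hu
        subst hu
        refine ⟨{u} ∪ Y, ?_, ?_⟩
        · rw [Finset.insert_eq]
          exact (isTransversalOn_singleton u).union hY (by simpa using hi)
            (hn.mono (by simp) subset_rfl)
        · rw [← Finset.insert_eq]
          exact (hn.mono (Finset.subset_insert _ _) subset_rfl).insert_right huR
    · exact Or.inr ⟨K, hK.trans (Finset.subset_insert _ _), h⟩

end Haxell

/-! ### Trees and forests of induced matchings -/

/-- The edge `xy` joins two disjoint systems, with parts `B₁`, `B₂` and vertices `D₁`, `D₂`, and
no other edge runs between `{x, y}`, `D₁` and `D₂`. -/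
structure Joins {V ι : Type*} (G : SimpleGraph V) (c : V → ι) (B₁ B₂ : Finset ι)
    (D₁ D₂ : Finset V) (x y : V) : Prop where
  disjoint : Disjoint B₁ B₂
  left_mem : c x ∈ B₁
  right_mem : c y ∈ B₂
  adj : G.Adj x y
  left_left : ¬ Dominates G D₁ x
  left_right : ¬ Dominates G D₂ x
  right_left : ¬ Dominates G D₁ y
  right_right : ¬ Dominates G D₂ y
  nonadj : Nonadj G D₁ D₂

/-- `D` is the vertex set of an induced matching whose edges form a spanning tree on the set of
parts `B`. -/
inductive IndTree {V ι : Type*} [DecidableEq V] [DecidableEq ι] (G : SimpleGraph V) (c : V → ι) :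
    Finset ι → Finset V → Prop
  | single (i : ι) : IndTree G c {i} ∅
  | join {B₁ B₂ : Finset ι} {D₁ D₂ : Finset V} {x y : V} (h₁ : IndTree G c B₁ D₁)
      (h₂ : IndTree G c B₂ D₂) (h : Joins G c B₁ B₂ D₁ D₂ x y) :
      IndTree G c (B₁ ∪ B₂) (insert x (insert y (D₁ ∪ D₂)))

/-- A family of induced tree matchings on disjoint sets of parts without edges between them. -/
structure IsForest {V ι A : Type*} [DecidableEq V] [DecidableEq ι] (G : SimpleGraph V) (c : V → ι)
    (B : A → Finset ι) (D : A → Finset V) : Prop where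
  tree : ∀ a, IndTree G c (B a) (D a)
  disjoint : ∀ a b, a ≠ b → Disjoint (B a) (B b)
  nonadj : ∀ a b, a ≠ b → Nonadj G (D a) (D b)

section Forest

set_option linter.unusedSectionVars false

variable {V ι : Type*} [DecidableEq V] [DecidableEq ι] {G : SimpleGraph V} {c : V → ι}

theorem Joins.symm {B₁ B₂ : Finset ι} {D₁ D₂ : Finset V} {x y : V}
    (h : Joins G c B₁ B₂ D₁ D₂ x y) : Joins G c B₂ B₁ D₂ D₁ y x :=
  ⟨h.disjoint.symm, h.right_mem, h.left_mem, h.adj.symm, h.right_right, h.right_left,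
    h.left_right, h.left_left, h.nonadj.symm⟩

theorem IndTree.nonempty {B : Finset ι} {D : Finset V} (h : IndTree G c B D) : B.Nonempty := by
  induction h with
  | single i => exact Finset.singleton_nonempty i
  | join _ _ _ h₁ _ => exact h₁.mono Finset.subset_union_left

theorem IndTree.dominates {B : Finset ι} {D : Finset V} (h : IndTree G c B D) :
    ∀ x ∈ D, Dominates G D x := by
  induction h with
  | single i => simp
  | @join _ _ _ _ x y _ _ h h₁ h₂ =>
    intro z hz
    simp only [Finset.mem_insert, Finset.mem_union] at hz
    rcases hz with rfl | rfl | hz | hz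
    · exact ⟨y, by simp, h.adj.symm⟩
    · exact ⟨x, by simp, h.adj⟩
    · exact (h₁ z hz).mono (by intro t; simp +contextual)
    · exact (h₂ z hz).mono (by intro t; simp +contextual)

theorem IndTree.card_le {B : Finset ι} {D : Finset V} (h : IndTree G c B D) :
    D.card + 2 ≤ 2 * B.card := by
  induction h with
  | single i => simp
  | @join B₁ B₂ D₁ D₂ x y _ _ h h₁ h₂ =>
    have e1 := Finset.card_union_of_disjoint h.disjoint
    have e2 := Finset.card_insert_le x (insert y (D₁ ∪ D₂))
    have e3 := Finset.card_insert_le y (D₁ ∪ D₂)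
    have e4 := Finset.card_union_le D₁ D₂
    omega

theorem not_dominates_insert {D : Finset V} {x v : V} (hx : ¬ G.Adj x v)
    (h : ¬ Dominates G D v) : ¬ Dominates G (insert x D) v := by
  rintro ⟨y, hy, hyv⟩
  rcases Finset.mem_insert.1 hy with rfl | hy
  exacts [hx hyv, h ⟨y, hy, hyv⟩]

theorem not_dominates_union {D D' : Finset V} {v : V} (h : ¬ Dominates G D v)
    (h' : ¬ Dominates G D' v) : ¬ Dominates G (D ∪ D') v := by
  rintro ⟨y, hy, hyv⟩
  rcases Finset.mem_union.1 hy with hy | hy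
  exacts [h ⟨y, hy, hyv⟩, h' ⟨y, hy, hyv⟩]

theorem not_dominates_mono {D D' : Finset V} {v : V} (h : ¬ Dominates G D v) (hD : D' ⊆ D) :
    ¬ Dominates G D' v :=
  fun h' => h (h'.mono hD)

/-- Two consecutive joins commute: if the later edge `xy` meets the `B₁` side of `pq`, then `B₃` can
be attached to `B₁` first and `pq` added last. -/
theorem IndTree.attach {B₁ B₂ B₃ : Finset ι} {D₁ D₂ D₃ : Finset V} {p q x y : V}
    (h₁ : IndTree G c B₁ D₁) (h₃ : IndTree G c B₃ D₃) (h : Joins G c B₁ B₂ D₁ D₂ p q)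
    (h' : Joins G c (B₁ ∪ B₂) B₃ (insert p (insert q (D₁ ∪ D₂))) D₃ x y) (hx : c x ∈ B₁) :
    IndTree G c (B₁ ∪ B₃) (insert x (insert y (D₁ ∪ D₃))) ∧
      Joins G c (B₁ ∪ B₃) B₂ (insert x (insert y (D₁ ∪ D₃))) D₂ p q := by
  have s1 : D₁ ⊆ insert p (insert q (D₁ ∪ D₂)) := by intro t; simp +contextual
  have s2 : D₂ ⊆ insert p (insert q (D₁ ∪ D₂)) := by intro t; simp +contextual
  have hd := Finset.disjoint_union_left.1 h'.disjoint
  have hxp : ¬ G.Adj x p := fun e => h'.left_left ⟨p, by simp, e.symm⟩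
  have hxq : ¬ G.Adj x q := fun e => h'.left_left ⟨q, by simp, e.symm⟩
  have hyp : ¬ G.Adj y p := fun e => h'.right_left ⟨p, by simp, e.symm⟩
  have hyq : ¬ G.Adj y q := fun e => h'.right_left ⟨q, by simp, e.symm⟩
  have h3p : ¬ Dominates G D₃ p := h'.nonadj.symm.not_dominates (by simp)
  have h3q : ¬ Dominates G D₃ q := h'.nonadj.symm.not_dominates (by simp)
  constructor
  · exact .join h₁ h₃ ⟨hd.1, hx, h'.right_mem, h'.adj, not_dominates_mono h'.left_left s1,
      h'.left_right, not_dominates_mono h'.right_left s1, h'.right_right,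
      h'.nonadj.mono s1 subset_rfl⟩
  · exact ⟨Finset.disjoint_union_left.2 ⟨h.disjoint, hd.2.symm⟩,
      Finset.mem_union_left _ h.left_mem, h.right_mem, h.adj,
      not_dominates_insert hxp (not_dominates_insert hyp (not_dominates_union h.left_left h3p)),
      h.left_right,
      not_dominates_insert hxq (not_dominates_insert hyq (not_dominates_union h.right_left h3q)),
      h.right_right,
      Nonadj.insert_left (Nonadj.insert_left
        (h.nonadj.union_left (h'.nonadj.symm.mono subset_rfl s2))
        (not_dominates_mono h'.right_left s2)) (not_dominates_mono h'.left_left s2)⟩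

/-- Every edge of an induced tree matching can be taken to be the last one that was added. -/
theorem IndTree.exists_split {B : Finset ι} {D : Finset V} (h : IndTree G c B D) :
    ∀ x ∈ D, ∃ y B₁ B₂ D₁ D₂, IndTree G c B₁ D₁ ∧ IndTree G c B₂ D₂ ∧
      Joins G c B₁ B₂ D₁ D₂ x y ∧ B = B₁ ∪ B₂ ∧ D = insert x (insert y (D₁ ∪ D₂)) := by
  induction h with
  | single i => simp
  | @join B₁ B₂ D₁ D₂ x y t₁ t₂ h h₁ h₂ =>
    have key : ∀ {B₁ B₂ : Finset ι} {D₁ D₂ : Finset V} {x y : V}, IndTree G c B₁ D₁ →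
        IndTree G c B₂ D₂ → Joins G c B₁ B₂ D₁ D₂ x y →
        (∀ z ∈ D₁, ∃ y B₁' B₂' D₁' D₂', IndTree G c B₁' D₁' ∧ IndTree G c B₂' D₂' ∧
          Joins G c B₁' B₂' D₁' D₂' z y ∧ B₁ = B₁' ∪ B₂' ∧
          D₁ = insert z (insert y (D₁' ∪ D₂'))) →
        ∀ z ∈ D₁, ∃ w B₁' B₂' D₁' D₂', IndTree G c B₁' D₁' ∧ IndTree G c B₂' D₂' ∧
          Joins G c B₁' B₂' D₁' D₂' z w ∧ B₁ ∪ B₂ = B₁' ∪ B₂' ∧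
          insert x (insert y (D₁ ∪ D₂)) = insert z (insert w (D₁' ∪ D₂')) := by
      intro B₁ B₂ D₁ D₂ x y t₁ t₂ h h₁ z hz
      obtain ⟨w, X₁, X₂, E₁, E₂, s₁, s₂, j, rfl, rfl⟩ := h₁ z hz
      rcases Finset.mem_union.1 h.left_mem with hx | hx
      · obtain ⟨u, k⟩ := s₁.attach t₂ j h hx
        refine ⟨w, _, _, _, _, u, s₂, k, ?_, ?_⟩
        · ext; simp only [Finset.mem_union]; tauto
        · ext; simp only [Finset.mem_union, Finset.mem_insert]; tauto
      · have h' : Joins G c (X₂ ∪ X₁) B₂ (insert w (insert z (E₂ ∪ E₁))) D₂ x y := by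
          rwa [Finset.union_comm, Finset.insert_comm, Finset.union_comm E₂]
        obtain ⟨u, k⟩ := s₂.attach t₂ j.symm h' hx
        refine ⟨w, _, _, _, _, s₁, u, k.symm, ?_, ?_⟩
        · ext; simp only [Finset.mem_union]; tauto
        · ext; simp only [Finset.mem_union, Finset.mem_insert]; tauto
    intro z hz
    simp only [Finset.mem_insert, Finset.mem_union] at hz
    rcases hz with rfl | rfl | hz | hz
    · exact ⟨y, _, _, _, _, t₁, t₂, h, rfl, rfl⟩
    · exact ⟨x, _, _, _, _, t₂, t₁, h.symm, Finset.union_comm _ _, by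
        rw [Finset.insert_comm, Finset.union_comm]⟩
    · exact key t₁ t₂ h h₁ z hz
    · rw [Finset.union_comm B₁, Finset.insert_comm, Finset.union_comm D₁]
      exact key t₂ t₁ h.symm h₂ z hz

theorem Joins.not_mem {B₁ B₂ : Finset ι} {D₁ D₂ : Finset V} {x y : V}
    (h : Joins G c B₁ B₂ D₁ D₂ x y) (h₁ : IndTree G c B₁ D₁) (h₂ : IndTree G c B₂ D₂) :
    x ∉ D₁ ∪ D₂ := by
  intro hx
  rcases Finset.mem_union.1 hx with hx | hx
  exacts [h.left_left (h₁.dominates x hx), h.left_right (h₂.dominates x hx)]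

theorem IsTransversalOn.insert_of_erase {B : Finset ι} {D S : Finset V} {v : V} (hv : c v ∈ B)
    (hD : ¬ Dominates G D v) (hS : S ⊆ D) (h : IsTransversalOn G c (B.erase (c v)) S) :
    IsTransversalOn G c B (insert v S) := by
  have h1 := (isTransversalOn_singleton (G := G) (c := c) v).union h (by simp) (by
    intro x hx y hy hxy
    rw [Finset.mem_singleton.1 hx] at hxy
    exact hD ⟨y, hS hy, hxy.symm⟩)
  rwa [← Finset.insert_eq, Finset.insert_erase hv, ← Finset.insert_eq] at h1

/-- At a join with the omitted part on the side of `x`, the endpoint `y` fills its own part, and the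
other half of the tree supplies a transversal of its parts except that of `y`. -/
theorem IndTree.exists_transversal_erase {B : Finset ι} {D : Finset V} (h : IndTree G c B D) :
    ∀ i ∈ B, ∃ S ⊆ D, IsTransversalOn G c (B.erase i) S := by
  induction h with
  | single i =>
    intro j hj
    refine ⟨∅, subset_rfl, ⟨?_, by simp, by simp [Nonadj]⟩⟩
    rw [Finset.mem_singleton.1 hj]
    simp
  | @join B₁ B₂ D₁ D₂ x y t₁ t₂ h h₁ h₂ =>
    have key : ∀ {B₁ B₂ : Finset ι} {D₁ D₂ : Finset V} {x y : V},
        Joins G c B₁ B₂ D₁ D₂ x y →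
        (∀ i ∈ B₁, ∃ S ⊆ D₁, IsTransversalOn G c (B₁.erase i) S) →
        (∀ i ∈ B₂, ∃ S ⊆ D₂, IsTransversalOn G c (B₂.erase i) S) →
        ∀ i ∈ B₁, ∃ S ⊆ insert x (insert y (D₁ ∪ D₂)),
          IsTransversalOn G c ((B₁ ∪ B₂).erase i) S := by
      intro B₁ B₂ D₁ D₂ x y h h₁ h₂ i hi
      obtain ⟨S₁, hS₁, tS₁⟩ := h₁ i hi
      obtain ⟨S₂, hS₂, tS₂⟩ := h₂ _ h.right_mem
      have t := tS₁.union (IsTransversalOn.insert_of_erase h.right_mem h.right_right hS₂ tS₂)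
        (Finset.disjoint_of_subset_left (Finset.erase_subset _ _) h.disjoint)
        ((h.nonadj.mono hS₁ hS₂).insert_right (not_dominates_mono h.right_left hS₁))
      rw [← Finset.erase_eq_of_notMem (Finset.disjoint_left.1 h.disjoint hi),
        ← Finset.erase_union_distrib] at t
      refine ⟨_, ?_, t⟩
      intro z hz
      simp only [Finset.mem_union, Finset.mem_insert] at hz ⊢
      rcases hz with hz | rfl | hz
      exacts [Or.inr (Or.inr (Or.inl (hS₁ hz))), Or.inr (Or.inl rfl),
        Or.inr (Or.inr (Or.inr (hS₂ hz)))]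
    intro i hi
    rcases Finset.mem_union.1 hi with hi | hi
    · exact key h h₁ h₂ i hi
    · rw [Finset.union_comm B₁, Finset.insert_comm, Finset.union_comm D₁]
      exact key h.symm h₂ h₁ i hi

theorem IsForest.update {A : Type*} [DecidableEq A] {B : A → Finset ι} {D : A → Finset V}
    (h : IsForest G c B D) {b : A} {B' : Finset ι} {D' : Finset V} (ht : IndTree G c B' D')
    (hB : ∀ a, a ≠ b → Disjoint B' (B a)) (hD : ∀ a, a ≠ b → Nonadj G D' (D a)) :
    IsForest G c (Function.update B b B') (Function.update D b D') where
  tree a := by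
    rcases eq_or_ne a b with rfl | ha
    · simpa using ht
    · simpa [ha] using h.tree a
  disjoint a a' haa := by
    rcases eq_or_ne a b with rfl | ha
    · simpa [haa.symm] using hB a' haa.symm
    · rcases eq_or_ne a' b with rfl | ha'
      · simpa [ha] using (hB a ha).symm
      · simpa [ha, ha'] using h.disjoint a a' haa
  nonadj a a' haa := by
    rcases eq_or_ne a b with rfl | ha
    · simpa [haa.symm] using hD a' haa.symm
    · rcases eq_or_ne a' b with rfl | ha'
      · simpa [ha] using (hD a ha).symm
      · simpa [ha, ha'] using h.nonadj a a' haa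

/-- A forest of induced matchings together with undominated vertices in different trees and a
transversal of the remaining parts gives a large independent partial transversal. -/
theorem IsForest.exists_partial_transversal {A : Type*} [Fintype A] [Fintype ι]
    {B : A → Finset ι} {D : A → Finset V} (h : IsForest G c B D) (E : A → Finset V)
    {Y : Finset V} (hE : ∀ a, (E a).card ≤ 1) (hEB : ∀ a, ∀ v ∈ E a, c v ∈ B a)
    (hDE : ∀ a b, Nonadj G (D a) (E b)) (hEE : ∀ a b, a ≠ b → Nonadj G (E a) (E b))
    (hY : IsTransversalOn G c (Finset.univ \ Finset.univ.biUnion B) Y)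
    (hDY : ∀ a, Nonadj G (D a) Y) (hEY : ∀ a, Nonadj G (E a) Y) :
    ∃ T : Finset V, Nonadj G T T ∧ Set.InjOn c (T : Set V) ∧
      T.card + Fintype.card A = Fintype.card ι + ∑ a, (E a).card := by
  -- A tree with a marked vertex is covered completely, by leaving that vertex's part to it; any
  -- other tree loses one part.
  have hS : ∀ a, ∃ S ⊆ D a ∪ E a, Nonadj G S S ∧ Set.InjOn c (S : Set V) ∧
      (∀ v ∈ S, c v ∈ B a) ∧ S.card + 1 = (B a).card + (E a).card := by
    intro a
    rcases Finset.eq_empty_or_nonempty (E a) with h0 | ⟨v, hv⟩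
    · obtain ⟨i, hi⟩ := (h.tree a).nonempty
      obtain ⟨S, hS, t⟩ := (h.tree a).exists_transversal_erase i hi
      refine ⟨S, hS.trans Finset.subset_union_left, t.indep, t.injOn,
        fun v hv => Finset.mem_of_mem_erase (t.mem hv), ?_⟩
      rw [t.card_eq, h0, Finset.card_erase_add_one hi]
      simp
    · have hE1 : (E a).card = 1 := le_antisymm (hE a) (Finset.card_pos.2 ⟨v, hv⟩)
      obtain ⟨S, hS, t⟩ := (h.tree a).exists_transversal_erase _ (hEB a v hv)
      have t' := IsTransversalOn.insert_of_erase (hEB a v hv) ((hDE a a).not_dominates hv) hS t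
      refine ⟨insert v S, ?_, t'.indep, t'.injOn, fun v hv => t'.mem hv, ?_⟩
      · exact Finset.insert_subset (Finset.mem_union_right _ hv)
          (hS.trans Finset.subset_union_left)
      · rw [t'.card_eq, hE1]
  choose S hSsub hSi hSc hSB hScard using hS
  have hcross : ∀ a b, a ≠ b → Nonadj G (S a) (S b) := fun a b hab =>
    Nonadj.mono (((h.nonadj a b hab).union_right (hDE a b)).union_left
      ((hDE b a).symm.union_right (hEE a b hab))) (hSsub a) (hSsub b)
  have hUU : Nonadj G (Finset.univ.biUnion S) (Finset.univ.biUnion S) := by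
    intro x hx y hy
    obtain ⟨a, -, hxa⟩ := Finset.mem_biUnion.1 hx
    obtain ⟨b, -, hyb⟩ := Finset.mem_biUnion.1 hy
    rcases eq_or_ne a b with rfl | hab
    exacts [hSi a x hxa y hyb, hcross a b hab x hxa y hyb]
  have hUY : Nonadj G (Finset.univ.biUnion S) Y := by
    intro x hx
    obtain ⟨a, -, hxa⟩ := Finset.mem_biUnion.1 hx
    exact ((hDY a).union_left (hEY a)) x (hSsub a hxa)
  have hUB : ∀ x ∈ Finset.univ.biUnion S, c x ∈ Finset.univ.biUnion B := by
    intro x hx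
    obtain ⟨a, -, hxa⟩ := Finset.mem_biUnion.1 hx
    exact Finset.mem_biUnion.2 ⟨a, Finset.mem_univ a, hSB a x hxa⟩
  have hUc : Set.InjOn c ((Finset.univ.biUnion S : Finset V) : Set V) := by
    intro x hx y hy hxy
    obtain ⟨a, -, hxa⟩ := Finset.mem_biUnion.1 (Finset.mem_coe.1 hx)
    obtain ⟨b, -, hyb⟩ := Finset.mem_biUnion.1 (Finset.mem_coe.1 hy)
    rcases eq_or_ne a b with rfl | hab
    · exact hSc a hxa hyb hxy
    · exact (Finset.disjoint_left.1 (h.disjoint a b hab) (hSB a x hxa)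
        (hxy ▸ hSB b y hyb)).elim
  have hUYd : Disjoint (Finset.univ.biUnion S) Y := by
    rw [Finset.disjoint_left]
    intro x hx hxY
    exact (Finset.mem_sdiff.1 (hY.mem hxY)).2 (hUB x hx)
  refine ⟨Finset.univ.biUnion S ∪ Y,
    (hUU.union_left hUY.symm).union_right (hUY.union_left hY.indep),
    injOn_union_of_disjoint hUc hY.injOn hUB (fun _ => hY.mem) Finset.disjoint_sdiff, ?_⟩
  have e1 : (Finset.univ.biUnion S).card = ∑ a, (S a).card := by
    refine Finset.card_biUnion fun a _ b _ hab => Finset.disjoint_left.2 ?_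
    intro x hxa hxb
    exact Finset.disjoint_left.1 (h.disjoint a b hab) (hSB a x hxa) (hSB b x hxb)
  have e2 : (Finset.univ.biUnion B).card = ∑ a, (B a).card :=
    Finset.card_biUnion fun a _ b _ hab => h.disjoint a b hab
  have e3 := Finset.card_sdiff_add_card_eq_card (Finset.subset_univ (Finset.univ.biUnion B))
  have e4 : ∑ a, (S a).card + Fintype.card A = ∑ a, (B a).card + ∑ a, (E a).card := by
    rw [Fintype.card_eq_sum_ones, ← Finset.sum_add_distrib, ← Finset.sum_add_distrib]
    exact Finset.sum_congr rfl fun a _ => hScard a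
  rw [Finset.card_union_of_disjoint hUYd, hY.card_eq]
  rw [Finset.card_univ] at e3
  omega

end Forest

/-! ### Growing a maximal forest; private neighbours -/

section Extremal

set_option linter.unusedSectionVars false

variable {V ι : Type*} [DecidableEq V] [DecidableEq ι] [Fintype V] [Fintype ι]
  {G : SimpleGraph V} {c : V → ι} [DecidableRel G.Adj] {Δ d : ℕ}

theorem card_parts_le_of_dominates (hdeg : ∀ x, (Finset.univ.filter (G.Adj x)).card ≤ Δ)
    {K : Finset ι} {X : Finset V} (h : ∀ v, c v ∈ K → Dominates G X v) :
    (Finset.univ.filter (fun v => c v ∈ K)).card ≤ X.card * Δ := by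
  refine (Finset.card_le_card ?_).trans
    (Finset.card_biUnion_le_card_mul X (fun x => Finset.univ.filter (G.Adj x)) Δ
      fun x _ => hdeg x)
  intro v hv
  obtain ⟨x, hx, hxv⟩ := h v (Finset.mem_filter.1 hv).2
  exact Finset.mem_biUnion.2 ⟨x, hx, Finset.mem_filter.2 ⟨Finset.mem_univ _, hxv⟩⟩

/-- Counting gives `4 * |K| < 2 * |X| + 4 * d + 5`; parity improves the constant to `4 * d + 4`. -/
theorem two_mul_card_le_of_dominates (hdeg : ∀ x, (Finset.univ.filter (G.Adj x)).card ≤ Δ)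
    (hsz : ∀ K : Finset ι, K.Nonempty →
      4 * Δ * K.card < 2 * (Finset.univ.filter (fun v => c v ∈ K)).card + Δ * (4 * d + 5))
    {K : Finset ι} {X : Finset V} (h : ∀ v, c v ∈ K → Dominates G X v) :
    2 * K.card ≤ X.card + 2 * d + 2 := by
  rcases K.eq_empty_or_nonempty with rfl | hK
  · simp
  · have h1 := hsz K hK
    have h2 := card_parts_le_of_dominates hdeg h
    have h3 : Δ * (4 * K.card) < Δ * (2 * X.card + 4 * d + 5) := by nlinarith
    have h4 := lt_of_mul_lt_mul_left h3 (Nat.zero_le Δ)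
    omega

/-- A tree on `m` parts has `m - 1` edges. With `d + 1` trees, this upper bound on the forest equals
the lower bound for sets dominating its parts. -/
theorem IsForest.card_biUnion {A : Type*} [Fintype A] {B : A → Finset ι} {D : A → Finset V}
    (h : IsForest G c B D) : (Finset.univ.biUnion D).card + 2 * Fintype.card A ≤
      2 * (Finset.univ.biUnion B).card := by
  have e1 : (Finset.univ.biUnion D).card ≤ ∑ a, (D a).card := Finset.card_biUnion_le
  have e2 : (Finset.univ.biUnion B).card = ∑ a, (B a).card :=
    Finset.card_biUnion fun a _ b _ hab => h.disjoint a b hab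
  have e3 : ∑ a, (D a).card + 2 * Fintype.card A ≤ 2 * ∑ a, (B a).card := by
    rw [Fintype.card_eq_sum_ones, Finset.mul_sum, Finset.mul_sum, ← Finset.sum_add_distrib]
    exact Finset.sum_le_sum fun a _ => by simpa using (h.tree a).card_le
  omega

/-- A violating vertex would complete its own tree, so only the other `d` trees would miss a part.
-/
theorem IsForest.blocked (hno : ∀ T : Finset V, Nonadj G T T → Set.InjOn c (T : Set V) →
      T.card + d < Fintype.card ι)
    {B : Fin (d + 1) → Finset ι} {D : Fin (d + 1) → Finset V} (h : IsForest G c B D) :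
    Blocked G c (Finset.univ.biUnion B) (Finset.univ.biUnion D)
      (Finset.univ \ Finset.univ.biUnion B) := by
  intro u Y hu huD hY hn
  obtain ⟨b, -, hb⟩ := Finset.mem_biUnion.1 hu
  have hmem : ∀ {a v}, v ∈ (if a = b then {u} else ∅ : Finset V) → a = b ∧ v = u := by
    intro a v hv
    split_ifs at hv with hab
    · exact ⟨hab, Finset.mem_singleton.1 hv⟩
    · simp at hv
  obtain ⟨T, hT, hTc, hcard⟩ := h.exists_partial_transversal
    (fun a => if a = b then {u} else ∅) (Y := Y)
    (fun a => by split_ifs <;> simp)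
    (fun a v hv => by obtain ⟨rfl, rfl⟩ := hmem hv; exact hb)
    (fun a a' x hx v hv hxv => by
      obtain ⟨rfl, rfl⟩ := hmem hv
      exact huD ⟨x, Finset.mem_biUnion.2 ⟨a, Finset.mem_univ _, hx⟩, hxv⟩)
    (fun a a' haa x hx y hy => by
      obtain ⟨rfl, rfl⟩ := hmem hx
      exact (haa (hmem hy).1.symm).elim)
    hY
    (fun a => hn.mono ((Finset.subset_biUnion_of_mem D (Finset.mem_univ a)).trans
      (Finset.subset_insert _ _)) subset_rfl)
    (fun a x hx => by
      obtain ⟨rfl, rfl⟩ := hmem hx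
      exact hn x (Finset.mem_insert_self _ _))
  have := hno T hT hTc
  simp only [apply_ite Finset.card, Finset.card_singleton, Finset.card_empty,
    Finset.sum_ite_eq', Finset.mem_univ, if_true, Fintype.card_fin] at hcard
  omega

/-- A forest of induced matchings that is compatible with an independent transversal of the
remaining parts. -/
def IsExtendableForest {A : Type*} [Fintype A] (G : SimpleGraph V) (c : V → ι)
    (B : A → Finset ι) (D : A → Finset V) : Prop :=
  IsForest G c B D ∧ ∃ Y, IsTransversalOn G c (Finset.univ \ Finset.univ.biUnion B) Y ∧
    Nonadj G (Finset.univ.biUnion D) Y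

/-- The parts missed by a largest partial transversal are blocked, and the resulting dominating set
shows that at most `d + 1` of them exist; they serve as one-part trees. -/
theorem exists_isExtendableForest (hdeg : ∀ x, (Finset.univ.filter (G.Adj x)).card ≤ Δ)
    (hsz : ∀ K : Finset ι, K.Nonempty →
      4 * Δ * K.card < 2 * (Finset.univ.filter (fun v => c v ∈ K)).card + Δ * (4 * d + 5))
    (hno : ∀ T : Finset V, Nonadj G T T → Set.InjOn c (T : Set V) →
      T.card + d < Fintype.card ι) :
    ∃ (B : Fin (d + 1) → Finset ι) (D : Fin (d + 1) → Finset V), IsExtendableForest G c B D := by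
  classical
  obtain ⟨T, hT, hmax⟩ := Finset.exists_max_image
    (Finset.univ.filter fun T : Finset V => Nonadj G T T ∧ Set.InjOn c (T : Set V)) Finset.card
    ⟨∅, Finset.mem_filter.2 ⟨Finset.mem_univ _, by simp [Nonadj], by simp⟩⟩
  obtain ⟨-, hT, hTc⟩ := Finset.mem_filter.1 hT
  have hTt : IsTransversalOn G c (T.image c) T := ⟨rfl, hTc, hT⟩
  set U := Finset.univ \ T.image c with hU
  have hB : Blocked G c U ∅ (T.image c) := by
    intro u Y hu _ hY hn
    have hd : Disjoint {c u} (T.image c) :=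
      Finset.disjoint_singleton_left.2 (Finset.mem_sdiff.1 hu).2
    have hY' := (isTransversalOn_singleton (G := G) (c := c) u).union hY hd hn
    have h1 := hmax _ (Finset.mem_filter.2 ⟨Finset.mem_univ _, hY'.indep, hY'.injOn⟩)
    have h2 := hY'.card_eq
    have h3 := Finset.card_union_of_disjoint hd
    rw [Finset.card_singleton, ← hTt.card_eq] at h3
    omega
  obtain ⟨S, hS, D', hD', hdom⟩ := hB.exists_dominating ⟨T, hTt, by simp [Nonadj]⟩
  have h1 := two_mul_card_le_of_dominates hdeg hsz hdom
  have h4 : (U ∪ S).card = U.card + S.card := Finset.card_union_of_disjoint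
    (Finset.disjoint_of_subset_right hS Finset.sdiff_disjoint)
  rw [Finset.empty_union] at h1
  have h2 := hno T hT hTc
  have h3 := Finset.card_sdiff_add_card_eq_card (Finset.subset_univ (T.image c))
  rw [← hU, Finset.card_univ, ← hTt.card_eq] at h3
  have hUcard : U.card = d + 1 := by omega
  let e := Finset.equivFinOfCardEq hUcard
  have hUe : Finset.univ.biUnion (fun a => {((e.symm a : U) : ι)}) = U := by
    ext i
    simp only [Finset.mem_biUnion, Finset.mem_univ, true_and, Finset.mem_singleton]
    constructor
    · rintro ⟨a, rfl⟩
      exact (e.symm a).2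
    · intro hi
      exact ⟨e ⟨i, hi⟩, by simp⟩
  refine ⟨fun a => {((e.symm a : U) : ι)}, fun _ => ∅, ⟨fun a => .single _, ?_, ?_⟩, T, ?_, ?_⟩
  · intro a b hab
    simpa [Subtype.ext_iff.symm] using hab
  · simp [Nonadj]
  · rwa [hUe, hU, Finset.sdiff_sdiff_eq_self (Finset.subset_univ _)]
  · simp [Nonadj]

/-- Adding `u` and its neighbours `E` costs `|E| + 1` vertices for `|E|` parts. Tightness forces `2
* |E| ≤ |E| + 1`, so `E` is a single vertex `e` and `ue` is a new tree edge. -/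
theorem IsExtendableForest.exists_larger (hdeg : ∀ x, (Finset.univ.filter (G.Adj x)).card ≤ Δ)
    (hsz : ∀ K : Finset ι, K.Nonempty →
      4 * Δ * K.card < 2 * (Finset.univ.filter (fun v => c v ∈ K)).card + Δ * (4 * d + 5))
    (hno : ∀ T : Finset V, Nonadj G T T → Set.InjOn c (T : Set V) →
      T.card + d < Fintype.card ι)
    {B : Fin (d + 1) → Finset ι} {D : Fin (d + 1) → Finset V} (h : IsExtendableForest G c B D)
    {u : V} (hu : c u ∈ Finset.univ.biUnion B) (huD : ¬ Dominates G (Finset.univ.biUnion D) u) :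
    ∃ (B' : Fin (d + 1) → Finset ι) (D' : Fin (d + 1) → Finset V), IsExtendableForest G c B' D' ∧
      (Finset.univ.biUnion B).card < (Finset.univ.biUnion B').card := by
  obtain ⟨hF, hY⟩ := h
  obtain ⟨Y, hY, hDY, hmin⟩ := exists_transversal_minimizing u hY
  obtain ⟨hE, hB', hY', hDY'⟩ := (hF.blocked hno).step hu huD hY hDY hmin
  set E := Y.filter (G.Adj u)
  have hEY : E ⊆ Y := Finset.filter_subset _ _
  have hPE : E.image c ⊆ Finset.univ \ Finset.univ.biUnion B :=
    hY.image_eq ▸ Finset.image_subset_image hEY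
  have hE1 : E.card = 1 := by
    obtain ⟨S, hS, D', hD', hdom⟩ := hB'.exists_dominating ⟨_, hY', hDY'⟩
    have h1 := two_mul_card_le_of_dominates hdeg hsz hdom
    have h2 := hF.card_biUnion
    have h3 : (Finset.univ.biUnion B ∪ E.image c ∪ S).card =
        (Finset.univ.biUnion B).card + E.card + S.card := by
      rw [Finset.card_union_of_disjoint, Finset.card_union_of_disjoint,
        Finset.card_image_of_injOn (hY.subset hEY).injOn]
      · exact Finset.disjoint_of_subset_right hPE Finset.disjoint_sdiff
      · rw [Finset.disjoint_union_left]
        exact ⟨Finset.disjoint_of_subset_right (hS.trans Finset.sdiff_subset)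
          Finset.disjoint_sdiff, Finset.disjoint_of_subset_right hS Finset.disjoint_sdiff⟩
    have h4 := Finset.card_union_le (insert u (Finset.univ.biUnion D ∪ E)) D'
    have h5 := Finset.card_insert_le u (Finset.univ.biUnion D ∪ E)
    have h6 := Finset.card_union_le (Finset.univ.biUnion D) E
    have h7 := hE.card_pos
    rw [Fintype.card_fin] at h2
    omega
  obtain ⟨e, he⟩ := Finset.card_eq_one.1 hE1
  have heE : e ∈ E := by rw [he]; simp
  have heY : e ∈ Y := hEY heE
  have hue : G.Adj u e := (Finset.mem_filter.1 heE).2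
  have heD : ¬ Dominates G (Finset.univ.biUnion D) e := hDY.not_dominates heY
  have heB : c e ∉ Finset.univ.biUnion B := (Finset.mem_sdiff.1 (hY.mem heY)).2
  rw [he] at hDY'
  rw [he, Finset.image_singleton] at hY'
  obtain ⟨b, -, hb⟩ := Finset.mem_biUnion.1 hu
  have hBsub : ∀ a, B a ⊆ Finset.univ.biUnion B := fun a =>
    Finset.subset_biUnion_of_mem B (Finset.mem_univ a)
  have hDsub : ∀ a, D a ⊆ Finset.univ.biUnion D := fun a =>
    Finset.subset_biUnion_of_mem D (Finset.mem_univ a)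
  have ht : IndTree G c (B b ∪ {c e}) (insert u (insert e (D b ∪ ∅))) :=
    .join (hF.tree b) (.single (c e)) ⟨by simpa using fun h => heB (hBsub b h), hb, by simp, hue,
      not_dominates_mono huD (hDsub b), by simp [Dominates],
      not_dominates_mono heD (hDsub b), by simp [Dominates], by simp [Nonadj]⟩
  rw [Finset.union_empty] at ht
  have hU : Finset.univ.biUnion (Function.update B b (B b ∪ {c e})) =
      Finset.univ.biUnion B ∪ {c e} := by
    ext i
    simp only [Finset.mem_biUnion, Finset.mem_univ, true_and, Finset.mem_union,
      Finset.mem_singleton]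
    constructor
    · rintro ⟨a, ha⟩
      rcases eq_or_ne a b with rfl | hab
      · rw [Function.update_self, Finset.mem_union, Finset.mem_singleton] at ha
        exact ha.imp_left fun h => ⟨_, h⟩
      · rw [Function.update_of_ne hab] at ha
        exact Or.inl ⟨a, ha⟩
    · rintro (⟨a, ha⟩ | rfl)
      · refine ⟨a, ?_⟩
        rcases eq_or_ne a b with rfl | hab
        · simp [ha]
        · simpa [hab] using ha
      · exact ⟨b, by simp⟩
  have hUD : Finset.univ.biUnion (Function.update D b (insert u (insert e (D b)))) ⊆
      insert u (Finset.univ.biUnion D ∪ {e}) := by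
    intro x hx
    obtain ⟨a, -, ha⟩ := Finset.mem_biUnion.1 hx
    rcases eq_or_ne a b with rfl | hab
    · simp only [Function.update_self, Finset.mem_insert] at ha
      rcases ha with rfl | rfl | ha
      · simp
      · simp
      · exact Finset.mem_insert_of_mem (Finset.mem_union_left _ (hDsub a ha))
    · rw [Function.update_of_ne hab] at ha
      exact Finset.mem_insert_of_mem (Finset.mem_union_left _ (hDsub a ha))
  refine ⟨_, _, ⟨hF.update ht ?_ ?_, Y \ {e}, ?_, hDY'.mono hUD subset_rfl⟩, ?_⟩
  · intro a hab
    rw [Finset.disjoint_union_left]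
    exact ⟨hF.disjoint b a hab.symm, by simpa using fun h => heB (hBsub a h)⟩
  · intro a hab
    exact ((hF.nonadj b a hab.symm).insert_left (not_dominates_mono heD (hDsub a))).insert_left
      (not_dominates_mono huD (hDsub a))
  · rw [hU]
    convert hY' using 1
    ext i
    simp only [Finset.mem_sdiff, Finset.mem_union]
    tauto
  · rw [hU, Finset.card_union_of_disjoint (by simpa using heB)]
    simp

/-- Otherwise the forest, `v` and few further vertices would dominate too many parts: the saving of
2 in `exists_transversal_or_dominating` outweighs the one extra vertex `v`. -/
theorem IsForest.exists_transversal_avoiding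
    (hdeg : ∀ x, (Finset.univ.filter (G.Adj x)).card ≤ Δ)
    (hsz : ∀ K : Finset ι, K.Nonempty →
      4 * Δ * K.card < 2 * (Finset.univ.filter (fun v => c v ∈ K)).card + Δ * (4 * d + 5))
    {B : Fin (d + 1) → Finset ι} {D : Fin (d + 1) → Finset V} (h : IsForest G c B D)
    (hdom : ∀ v, c v ∈ Finset.univ.biUnion B → Dominates G (Finset.univ.biUnion D) v) (v : V) :
    ∃ Y, IsTransversalOn G c (Finset.univ \ Finset.univ.biUnion B) Y ∧
      Nonadj G (insert v (Finset.univ.biUnion D)) Y := by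
  rcases exists_transversal_or_dominating (G := G) (c := c)
    (insert v (Finset.univ.biUnion D)) (Finset.univ \ Finset.univ.biUnion B) with
    hY | ⟨K, hK, D', hD', hK'⟩
  · exact hY
  · exfalso
    have h1 := two_mul_card_le_of_dominates (K := Finset.univ.biUnion B ∪ K) hdeg hsz
      (X := insert v (Finset.univ.biUnion D) ∪ D') (by
        intro w hw
        rcases Finset.mem_union.1 hw with hw | hw
        · exact (hdom w hw).mono
            ((Finset.subset_insert _ _).trans Finset.subset_union_left)
        · exact hK' w hw)
    have h2 := h.card_biUnion
    have h3 := Finset.card_union_le (insert v (Finset.univ.biUnion D)) D'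
    have h4 := Finset.card_insert_le v (Finset.univ.biUnion D)
    rw [Finset.card_union_of_disjoint
      (Finset.disjoint_of_subset_right hK Finset.disjoint_sdiff)] at h1
    rw [Fintype.card_fin] at h2
    omega

/-- The vertices in the parts `J` whose only neighbour in `D` is `x`. -/
def privateNeighbors (G : SimpleGraph V) [DecidableRel G.Adj] (c : V → ι) (J : Finset ι)
    (D : Finset V) (x : V) : Finset V :=
  Finset.univ.filter fun z => c z ∈ J ∧ G.Adj x z ∧ ∀ w ∈ D, G.Adj w z → w = x

/-- The parts `J` have more than `2Δ|J| - Δ(4d + 5)/2` vertices, and the forest without `x`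
dominates at most `Δ(2|J| - 2d - 3)` of them; the difference is `Δ / 2`. -/
theorem IsForest.lt_two_mul_card_privateNeighbors
    (hdeg : ∀ x, (Finset.univ.filter (G.Adj x)).card ≤ Δ)
    (hsz : ∀ K : Finset ι, K.Nonempty →
      4 * Δ * K.card < 2 * (Finset.univ.filter (fun v => c v ∈ K)).card + Δ * (4 * d + 5))
    {B : Fin (d + 1) → Finset ι} {D : Fin (d + 1) → Finset V} (h : IsForest G c B D)
    (hdom : ∀ v, c v ∈ Finset.univ.biUnion B → Dominates G (Finset.univ.biUnion D) v) {x : V}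
    (hx : x ∈ Finset.univ.biUnion D) :
    Δ < 2 * (privateNeighbors G c (Finset.univ.biUnion B) (Finset.univ.biUnion D) x).card := by
  set J := Finset.univ.biUnion B
  set D' := Finset.univ.biUnion D
  have hJ : J.Nonempty := (h.tree 0).nonempty.mono
    (Finset.subset_biUnion_of_mem B (Finset.mem_univ 0))
  have h1 := hsz J hJ
  have h2 : D'.card + 2 * (d + 1) ≤ 2 * J.card := by simpa using h.card_biUnion
  have h3 : (Finset.univ.filter (fun v => c v ∈ J)) ⊆ privateNeighbors G c J D' x ∪
      (D'.erase x).biUnion fun x => Finset.univ.filter (G.Adj x) := by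
    intro v hv
    have hvJ := (Finset.mem_filter.1 hv).2
    rw [Finset.mem_union]
    by_cases hw : ∃ w ∈ D'.erase x, G.Adj w v
    · obtain ⟨w, hw, hwv⟩ := hw
      exact Or.inr (Finset.mem_biUnion.2 ⟨w, hw, by simpa using hwv⟩)
    · push Not at hw
      have hw' : ∀ w ∈ D', G.Adj w v → w = x := fun w hwD hwv => by
        by_contra hne
        exact hw w (Finset.mem_erase.2 ⟨hne, hwD⟩) hwv
      obtain ⟨w, hwD, hwv⟩ := hdom v hvJ
      obtain rfl := hw' w hwD hwv
      exact Or.inl (Finset.mem_filter.2 ⟨Finset.mem_univ _, hvJ, hwv, hw'⟩)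
  have h4 := (Finset.card_le_card h3).trans (Finset.card_union_le _ _)
  have h5 := Finset.card_biUnion_le_card_mul (D'.erase x)
    (fun x => Finset.univ.filter (G.Adj x)) Δ fun x _ => hdeg x
  have h6 := Finset.card_erase_add_one hx
  nlinarith [Nat.mul_le_mul_left (2 * Δ) h2]

end Extremal

/-! ### Exchanging the partner of a forest vertex -/

section Switching

set_option linter.unusedSectionVars false

variable {V ι : Type*} [DecidableEq V] [DecidableEq ι] [Fintype V] [Fintype ι]
  {G : SimpleGraph V} {c : V → ι} [DecidableRel G.Adj] {Δ d : ℕ}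

theorem IsForest.mem_of_adj {A : Type*} [Fintype A] {B : A → Finset ι} {D : A → Finset V}
    (h : IsForest G c B D) {a : A} {x y : V} (hx : x ∈ D a) (hy : y ∈ Finset.univ.biUnion D)
    (hxy : G.Adj x y) : y ∈ D a := by
  obtain ⟨b, -, hb⟩ := Finset.mem_biUnion.1 hy
  rcases eq_or_ne a b with rfl | hab
  exacts [hb, (h.nonadj a b hab x hx y hb hxy).elim]

/-- Splitting one tree of a forest at an edge. -/
theorem IsForest.split {A : Type*} [DecidableEq A] {B : A → Finset ι} {D : A → Finset V}
    (h : IsForest G c B D) {b : A} {x y : V} {B₁ B₂ : Finset ι} {D₁ D₂ : Finset V}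
    (h₁ : IndTree G c B₁ D₁) (h₂ : IndTree G c B₂ D₂) (hj : Joins G c B₁ B₂ D₁ D₂ x y)
    (hB : B b = B₁ ∪ B₂) (hD : D b = insert x (insert y (D₁ ∪ D₂))) :
    IsForest G c (fun o : Option A => o.elim B₁ (Function.update B b B₂))
      (fun o : Option A => o.elim D₁ (Function.update D b D₂)) := by
  have hB₁ : B₁ ⊆ B b := hB ▸ Finset.subset_union_left
  have hB₂ : B₂ ⊆ B b := hB ▸ Finset.subset_union_right
  have hD₁ : D₁ ⊆ D b := by rw [hD]; intro t; simp +contextual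
  have hD₂ : D₂ ⊆ D b := by rw [hD]; intro t; simp +contextual
  have hu := h.update (b := b) h₂
    (fun a ha => Finset.disjoint_of_subset_left hB₂ (h.disjoint b a ha.symm))
    (fun a ha => (h.nonadj b a ha.symm).mono hD₂ subset_rfl)
  have hBn : ∀ a, Disjoint B₁ (Function.update B b B₂ a) := by
    intro a
    rcases eq_or_ne a b with rfl | ha
    · simpa using hj.disjoint
    · simpa [ha] using Finset.disjoint_of_subset_left hB₁ (h.disjoint b a ha.symm)
  have hDn : ∀ a, Nonadj G D₁ (Function.update D b D₂ a) := by
    intro a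
    rcases eq_or_ne a b with rfl | ha
    · simpa using hj.nonadj
    · simpa [ha] using (h.nonadj b a ha.symm).mono hD₁ subset_rfl
  constructor
  · rintro (_ | a)
    exacts [h₁, hu.tree a]
  · rintro (_ | a) (_ | a') haa
    exacts [(haa rfl).elim, hBn a', (hBn a).symm, hu.disjoint a a' (by simpa using haa)]
  · rintro (_ | a) (_ | a') haa
    exacts [(haa rfl).elim, hDn a', (hDn a).symm, hu.nonadj a a' (by simpa using haa)]

/-- A private neighbour of `x` lies on the far side of the edge at `x`. -/
theorem IsForest.mem_of_mem_privateNeighbors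
    (hdeg : ∀ x, (Finset.univ.filter (G.Adj x)).card ≤ Δ)
    (hsz : ∀ K : Finset ι, K.Nonempty →
      4 * Δ * K.card < 2 * (Finset.univ.filter (fun v => c v ∈ K)).card + Δ * (4 * d + 5))
    (hno : ∀ T : Finset V, Nonadj G T T → Set.InjOn c (T : Set V) →
      T.card + d < Fintype.card ι)
    {B : Fin (d + 1) → Finset ι} {D : Fin (d + 1) → Finset V} (h : IsForest G c B D)
    (hdom : ∀ v, c v ∈ Finset.univ.biUnion B → Dominates G (Finset.univ.biUnion D) v)
    {b : Fin (d + 1)} {x y z : V} {B₁ B₂ : Finset ι} {D₁ D₂ : Finset V}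
    (h₁ : IndTree G c B₁ D₁) (h₂ : IndTree G c B₂ D₂) (hj : Joins G c B₁ B₂ D₁ D₂ x y)
    (hB : B b = B₁ ∪ B₂) (hD : D b = insert x (insert y (D₁ ∪ D₂)))
    (hz : z ∈ privateNeighbors G c (Finset.univ.biUnion B) (Finset.univ.biUnion D) x) :
    c z ∈ B₂ := by
  by_contra hz₂
  obtain ⟨-, hzJ, hxz, hzpriv⟩ := Finset.mem_filter.1 hz
  have hxb : x ∈ D b := by rw [hD]; simp
  have hyb : y ∈ D b := by rw [hD]; simp
  have hDsub : ∀ a, D a ⊆ Finset.univ.biUnion D := fun a =>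
    Finset.subset_biUnion_of_mem D (Finset.mem_univ a)
  have hxn : x ∉ D₁ ∪ D₂ := hj.not_mem h₁ h₂
  have hF := h.split h₁ h₂ hj hB hD
  set B' : Option (Fin (d + 1)) → Finset ι := fun o => o.elim B₁ (Function.update B b B₂) with hB'
  set D' : Option (Fin (d + 1)) → Finset V := fun o => o.elim D₁ (Function.update D b D₂) with hD'
  have hBU : Finset.univ.biUnion B' = Finset.univ.biUnion B := by
    ext i
    simp only [Finset.mem_biUnion, Finset.mem_univ, true_and]
    constructor
    · rintro ⟨_ | a, ha⟩
      · exact ⟨b, hB ▸ Finset.mem_union_left _ ha⟩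
      · rcases eq_or_ne a b with rfl | hab
        · refine ⟨a, hB ▸ Finset.mem_union_right _ ?_⟩
          simpa [hB'] using ha
        · exact ⟨a, by simpa [hB', hab] using ha⟩
    · rintro ⟨a, ha⟩
      rcases eq_or_ne a b with rfl | hab
      · rw [hB] at ha
        rcases Finset.mem_union.1 ha with ha | ha
        exacts [⟨none, ha⟩, ⟨some a, by simpa [hB'] using ha⟩]
      · exact ⟨some a, by simpa [hB', hab] using ha⟩
  have hD'sub : ∀ o, D' o ⊆ (Finset.univ.biUnion D) := by
    rintro (_ | a)
    · refine subset_trans ?_ (hDsub b)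
      rw [hD]
      intro t
      simp +contextual [hD']
    · rcases eq_or_ne a b with rfl | hab
      · refine subset_trans ?_ (hDsub a)
        rw [hD]
        intro t
        simp +contextual [hD']
      · simpa [hD', hab] using hDsub a
  have hD'x : ∀ o, x ∉ D' o := by
    rintro (_ | a) hx
    · exact hxn (Finset.mem_union_left _ hx)
    · rcases eq_or_ne a b with rfl | hab
      · exact hxn (Finset.mem_union_right _ (by simpa [hD'] using hx))
      · have hxa : x ∈ D a := by simpa [hD', hab] using hx
        exact h.nonadj a b hab x hxa y hyb hj.adj
  have hD'z : ∀ o, ¬ Dominates G (D' o) z := by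
    rintro o ⟨w, hw, hwz⟩
    exact hD'x o (hzpriv w (hD'sub o hw) hwz ▸ hw)
  have hD'y : ∀ o, ¬ Dominates G (D' o) y := by
    rintro (_ | a)
    · exact hj.right_left
    · rcases eq_or_ne a b with rfl | hab
      · simpa [hD'] using hj.right_right
      · simpa [hD', hab] using (h.nonadj a b hab).not_dominates hyb
  have hzy : ¬ G.Adj y z := fun hyz => hj.adj.ne (hzpriv y (hDsub b hyb) hyz).symm
  obtain ⟨o, -, hzo⟩ := Finset.mem_biUnion.1 (hBU.symm ▸ hzJ)
  have hob : o ≠ some b := by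
    rintro rfl
    exact hz₂ (by simpa [hB'] using hzo)
  obtain ⟨Y, hY, hDY⟩ := h.exists_transversal_avoiding hdeg hsz hdom z
  -- Removing `xy` leaves `d + 2` trees. If `z` were not on the side of `y`, then `z` and `y` would
  -- complete two different trees, so only `d` parts would be missed.
  let E : Option (Fin (d + 1)) → Finset V :=
    fun o' => if o' = o then {z} else if o' = some b then {y} else ∅
  have hmem : ∀ {o' v}, v ∈ E o' → o' = o ∧ v = z ∨ o' = some b ∧ v = y := by
    intro o' v hv
    by_cases h1 : o' = o
    · simp only [E, h1, if_true, Finset.mem_singleton] at hv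
      exact Or.inl ⟨h1, hv⟩
    · by_cases h2 : o' = some b
      · simp only [E, h2, hob.symm, if_true, if_false, Finset.mem_singleton] at hv
        exact Or.inr ⟨h2, hv⟩
      · simp [E, h1, h2] at hv
  have hEcard : ∀ o', (E o').card = (if o' = o then 1 else 0) + if o' = some b then 1 else 0 := by
    intro o'
    by_cases h1 : o' = o
    · simp [E, h1, hob]
    · by_cases h2 : o' = some b
      · simp [E, h2, hob.symm]
      · simp [E, h1, h2]
  obtain ⟨T, hT, hTc, hcard⟩ := hF.exists_partial_transversal E (Y := Y)
    (fun o' => by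
      rw [hEcard]
      by_cases h1 : o' = o
      · simp [h1, hob]
      · simp only [h1, if_false]
        split_ifs <;> simp)
    (fun o' v hv => by
      rcases hmem hv with ⟨rfl, rfl⟩ | ⟨rfl, rfl⟩
      · exact hzo
      · simpa [hB'] using hj.right_mem)
    (fun o₁ o₂ w hw v hv hwv => by
      rcases hmem hv with ⟨-, rfl⟩ | ⟨-, rfl⟩
      exacts [hD'z o₁ ⟨w, hw, hwv⟩, hD'y o₁ ⟨w, hw, hwv⟩])
    (fun o₁ o₂ ho w hw v hv hwv => by
      rcases hmem hw with ⟨rfl, rfl⟩ | ⟨rfl, rfl⟩ <;> rcases hmem hv with ⟨rfl, rfl⟩ | ⟨rfl, rfl⟩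
      exacts [ho rfl, hzy hwv.symm, hzy hwv, ho rfl])
    (by rwa [hBU])
    (fun o' => hDY.mono ((hD'sub o').trans (Finset.subset_insert _ _)) subset_rfl)
    (fun o' w hw => by
      rcases hmem hw with ⟨-, rfl⟩ | ⟨-, rfl⟩
      exacts [hDY _ (Finset.mem_insert_self _ _),
        hDY _ (Finset.mem_insert_of_mem (hDsub b hyb))])
  have h3 := hno T hT hTc
  have h4 : ∑ o', (E o').card = 2 := by
    simp only [hEcard, Finset.sum_add_distrib, Finset.sum_ite_eq', Finset.mem_univ, if_true]
  rw [h4] at hcard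
  simp only [Fintype.card_option, Fintype.card_fin] at hcard
  omega

/-- The partner of `x` can be exchanged for any private neighbour of `x`. -/
theorem IsForest.exists_switch
    (hdeg : ∀ x, (Finset.univ.filter (G.Adj x)).card ≤ Δ)
    (hsz : ∀ K : Finset ι, K.Nonempty →
      4 * Δ * K.card < 2 * (Finset.univ.filter (fun v => c v ∈ K)).card + Δ * (4 * d + 5))
    (hno : ∀ T : Finset V, Nonadj G T T → Set.InjOn c (T : Set V) →
      T.card + d < Fintype.card ι)
    {B : Fin (d + 1) → Finset ι} {D : Fin (d + 1) → Finset V} (h : IsForest G c B D)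
    (hdom : ∀ v, c v ∈ Finset.univ.biUnion B → Dominates G (Finset.univ.biUnion D) v)
    {b : Fin (d + 1)} {x z : V} (hx : x ∈ D b)
    (hz : z ∈ privateNeighbors G c (Finset.univ.biUnion B) (Finset.univ.biUnion D) x) :
    c z ∈ B b ∧ ∃ D', IsExtendableForest G c B (Function.update D b D') ∧
      ∀ y ∈ D b, G.Adj x y → D' ⊆ insert z ((D b).erase y) := by
  obtain ⟨y, B₁, B₂, D₁, D₂, h₁, h₂, hj, hB, hD⟩ := (h.tree b).exists_split x hx
  have hz₂ := h.mem_of_mem_privateNeighbors hdeg hsz hno hdom h₁ h₂ hj hB hD hz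
  obtain ⟨-, hzJ, hxz, hzpriv⟩ := Finset.mem_filter.1 hz
  have hDsub : ∀ a, D a ⊆ Finset.univ.biUnion D := fun a =>
    Finset.subset_biUnion_of_mem D (Finset.mem_univ a)
  have hxn : x ∉ D₁ ∪ D₂ := hj.not_mem h₁ h₂
  have hyn : y ∉ D₁ ∪ D₂ := by
    rw [Finset.union_comm]
    exact hj.symm.not_mem h₂ h₁
  have hyb : y ∈ D b := by rw [hD]; simp
  have hs : D₁ ∪ D₂ ⊆ D b := by rw [hD]; intro t; simp +contextual
  have hzD : ∀ X ⊆ Finset.univ.biUnion D, x ∉ X → ¬ Dominates G X z := by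
    rintro X hX hxX ⟨w, hw, hwz⟩
    exact hxX (hzpriv w (hX hw) hwz ▸ hw)
  -- As `z` lies on the far side and sees no forest vertex but `x`, the edge `xz` reconnects the
  -- same two halves.
  have hj' : Joins G c B₁ B₂ D₁ D₂ x z :=
    ⟨hj.disjoint, hj.left_mem, hz₂, hxz, hj.left_left, hj.left_right,
      hzD _ ((Finset.subset_union_left.trans hs).trans (hDsub b))
        (fun h => hxn (Finset.mem_union_left _ h)),
      hzD _ ((Finset.subset_union_right.trans hs).trans (hDsub b))
        (fun h => hxn (Finset.mem_union_right _ h)), hj.nonadj⟩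
  have hsub : insert x (insert z (D₁ ∪ D₂)) ⊆ insert z (D b) :=
    Finset.insert_subset (Finset.mem_insert_of_mem hx) (Finset.insert_subset_insert z hs)
  have ht := IndTree.join h₁ h₂ hj'
  rw [← hB] at ht
  refine ⟨hB ▸ Finset.mem_union_right _ hz₂, insert x (insert z (D₁ ∪ D₂)),
    ⟨?_, ?_⟩, ?_⟩
  · have hF := h.update (b := b) ht (fun a ha => h.disjoint b a ha.symm) (fun a ha => by
      refine Nonadj.mono (Nonadj.insert_left (h.nonadj b a ha.symm) (hzD _ (hDsub a) ?_))
        hsub subset_rfl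
      exact fun hxa => h.nonadj a b ha x hxa y hyb hj.adj)
    rwa [Function.update_eq_self] at hF
  · obtain ⟨Y, hY, hDY⟩ := h.exists_transversal_avoiding hdeg hsz hdom z
    refine ⟨Y, hY, hDY.mono ?_ subset_rfl⟩
    intro w hw
    obtain ⟨a, -, ha⟩ := Finset.mem_biUnion.1 hw
    rcases eq_or_ne a b with rfl | hab
    · rw [Function.update_self] at ha
      exact Finset.insert_subset_insert z (hDsub a) (hsub ha)
    · rw [Function.update_of_ne hab] at ha
      exact Finset.mem_insert_of_mem (hDsub a ha)
  · intro y' hy' hxy'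
    have hyy : y' = y := by
      rw [hD] at hy'
      simp only [Finset.mem_insert] at hy'
      rcases hy' with rfl | rfl | hy'
      · exact (G.irrefl hxy').elim
      · rfl
      · rcases Finset.mem_union.1 hy' with hy' | hy'
        exacts [(hj.left_left ⟨y', hy', hxy'.symm⟩).elim,
          (hj.left_right ⟨y', hy', hxy'.symm⟩).elim]
    subst hyy
    intro w hw
    simp only [Finset.mem_insert] at hw
    rcases hw with rfl | rfl | hw
    · exact Finset.mem_insert_of_mem (Finset.mem_erase.2 ⟨hj.adj.ne, hx⟩)
    · exact Finset.mem_insert_self _ _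
    · exact Finset.mem_insert_of_mem
        (Finset.mem_erase.2 ⟨fun h => hyn (h ▸ hw), hs hw⟩)

theorem IsForest.eq_of_adj {B : Fin (d + 1) → Finset ι} {D : Fin (d + 1) → Finset V}
    (h : IsForest G c B D) {x y y' : V} (hx : x ∈ Finset.univ.biUnion D)
    (hy : y ∈ Finset.univ.biUnion D) (hy' : y' ∈ Finset.univ.biUnion D)
    (hxy : G.Adj x y) (hxy' : G.Adj x y') : y = y' := by
  obtain ⟨b, -, hb⟩ := Finset.mem_biUnion.1 hx
  have hyb := h.mem_of_adj hb hy hxy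
  have hyb' := h.mem_of_adj hb hy' hxy'
  obtain ⟨w, B₁, B₂, D₁, D₂, h₁, h₂, hj, hB, hD⟩ := (h.tree b).exists_split x hb
  have key : ∀ v ∈ D b, G.Adj x v → v = w := by
    intro v hv hxv
    rw [hD] at hv
    simp only [Finset.mem_insert] at hv
    rcases hv with rfl | rfl | hv
    · exact (G.irrefl hxv).elim
    · rfl
    · rcases Finset.mem_union.1 hv with hv | hv
      exacts [(hj.left_left ⟨v, hv, hxv.symm⟩).elim, (hj.left_right ⟨v, hv, hxv.symm⟩).elim]
  rw [key y hyb hxy, key y' hyb' hxy']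

end Switching

/-! ### The minimal counterexample argument and the size bound -/

section Main

theorem exists_maximal_isExtendableForest {V ι : Type*} [DecidableEq V] [DecidableEq ι] [Fintype V]
    [Fintype ι] {G : SimpleGraph V} {c : V → ι} {d : ℕ}
    (h : ∃ (B : Fin (d + 1) → Finset ι) (D : Fin (d + 1) → Finset V),
      IsExtendableForest G c B D) :
    ∃ (B : Fin (d + 1) → Finset ι) (D : Fin (d + 1) → Finset V), IsExtendableForest G c B D ∧
      ∀ (B' : Fin (d + 1) → Finset ι) (D' : Fin (d + 1) → Finset V), IsExtendableForest G c B' D' →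
        (Finset.univ.biUnion B').card ≤ (Finset.univ.biUnion B).card := by
  classical
  obtain ⟨B, D, h⟩ := h
  obtain ⟨p, hp, hmax⟩ := Finset.exists_max_image
    (Finset.univ.filter fun p : (Fin (d + 1) → Finset ι) × (Fin (d + 1) → Finset V) =>
      IsExtendableForest G c p.1 p.2) (fun p => (Finset.univ.biUnion p.1).card)
    ⟨(B, D), Finset.mem_filter.2 ⟨Finset.mem_univ _, h⟩⟩
  exact ⟨p.1, p.2, (Finset.mem_filter.1 hp).2, fun B' D' h' =>
    hmax (B', D') (Finset.mem_filter.2 ⟨Finset.mem_univ _, h'⟩)⟩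

/-- A partial independent transversal that misses at most `d` parts exists as soon as the parts are
large on average and small collections of parts are large. -/
theorem exists_partial_transversal {V ι : Type*} [DecidableEq V] [DecidableEq ι] [Fintype V]
    [Fintype ι] {G : SimpleGraph V} {c : V → ι} [DecidableRel G.Adj] {Δ d q : ℕ}
    (hdeg : ∀ x, (Finset.univ.filter (G.Adj x)).card ≤ Δ)
    (hsz : ∀ K : Finset ι, K.Nonempty →
      4 * Δ * K.card < 2 * (Finset.univ.filter (fun v => c v ∈ K)).card + Δ * (4 * d + 5))
    (hsmall : ∀ Z : Finset ι, Z.Nonempty → Z.card ≤ q →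
      2 * Δ * Z.card < (Finset.univ.filter (fun v => c v ∈ Z)).card + 2 * Δ)
    (hq : Fintype.card ι < (q + 1) * (d + 1)) :
    ∃ T : Finset V, Nonadj G T T ∧ Set.InjOn c (T : Set V) ∧ Fintype.card ι ≤ T.card + d := by
  by_contra hcon
  have hno : ∀ T : Finset V, Nonadj G T T → Set.InjOn c (T : Set V) →
      T.card + d < Fintype.card ι := by
    intro T h1 h2
    by_contra h3
    exact hcon ⟨T, h1, h2, not_lt.1 h3⟩
  obtain ⟨B, D₀, hD₀, hmax⟩ := exists_maximal_isExtendableForest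
    (exists_isExtendableForest hdeg hsz hno)
  -- Maximality concerns only the number of parts, so domination holds for every extendable forest
  -- on `B` and survives switching.
  have hdom : ∀ D : Fin (d + 1) → Finset V, IsExtendableForest G c B D →
      ∀ v, c v ∈ Finset.univ.biUnion B → Dominates G (Finset.univ.biUnion D) v := by
    intro D hD v hv
    by_contra hvD
    obtain ⟨B', D', h', hlt⟩ := hD.exists_larger hdeg hsz hno hv hvD
    exact absurd (hmax B' D' h') (not_le.2 hlt)
  obtain ⟨a, ha⟩ : ∃ a, (B a).card ≤ q := by
    by_contra! hB
    have h1 : (Finset.univ.biUnion B).card = ∑ a, (B a).card :=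
      Finset.card_biUnion fun a _ b _ hab => hD₀.1.disjoint a b hab
    have h2 : ∑ _a : Fin (d + 1), (q + 1) ≤ ∑ a, (B a).card :=
      Finset.sum_le_sum fun a _ => hB a
    have h3 := Finset.card_le_univ (Finset.univ.biUnion B)
    simp only [Finset.sum_const, Finset.card_univ, Fintype.card_fin, smul_eq_mul] at h2
    rw [mul_comm] at hq
    omega
  -- Tree `a` has at most `2 * (|B a| - 1)` vertices, each of degree at most `Δ`, too few to
  -- dominate its parts by `hsmall`.
  obtain ⟨v, hva, hvD⟩ : ∃ v, c v ∈ B a ∧ ¬ Dominates G (D₀ a) v := by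
    by_contra! hall
    have h1 := card_parts_le_of_dominates hdeg hall
    have h2 := hsmall _ (hD₀.1.tree a).nonempty ha
    have h3 := (hD₀.1.tree a).card_le
    nlinarith [Nat.mul_le_mul_left Δ h3]
  have hvJ : c v ∈ Finset.univ.biUnion B := Finset.mem_biUnion.2 ⟨a, Finset.mem_univ a, hva⟩
  obtain ⟨D, ⟨hD, hDa⟩, hmin⟩ := exists_minimalFor_of_wellFoundedLT
    (fun D : Fin (d + 1) → Finset V => IsExtendableForest G c B D ∧ D a = D₀ a)
    (fun D => ((Finset.univ.biUnion D).filter fun x => G.Adj x v).card) ⟨D₀, hD₀, rfl⟩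
  have hF := hD.1
  have hsub : ∀ b, D b ⊆ Finset.univ.biUnion D := fun b =>
    Finset.subset_biUnion_of_mem D (Finset.mem_univ b)
  have hne : ∀ b, ∀ x ∈ D b, G.Adj x v → b ≠ a := by
    rintro b x hx hxv rfl
    exact hvD ⟨x, hDa ▸ hx, hxv⟩
  have hfull : ∀ b, ∀ x ∈ D b, G.Adj x v → ∃ y ∈ D b, G.Adj y x ∧
      privateNeighbors G c (Finset.univ.biUnion B) (Finset.univ.biUnion D) y ⊆
        Finset.univ.filter (G.Adj v) := by
    intro b x hx hxv
    obtain ⟨y, hy, hyx⟩ := (hF.tree b).dominates x hx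
    refine ⟨y, hy, hyx, fun z hz => ?_⟩
    -- Switching `x` for a `z` not adjacent to `v` would lower the number of forest neighbours of
    -- `v`; tree `a` is untouched since `b ≠ a`.
    by_contra hzv
    obtain ⟨-, D', hD', hsub'⟩ := hF.exists_switch hdeg hsz hno (hdom D hD) hy hz
    have hsub'' := hsub' x hx hyx
    have hss : (Finset.univ.biUnion (Function.update D b D')).filter (fun x => G.Adj x v) ⊆
        ((Finset.univ.biUnion D).filter (fun x => G.Adj x v)).erase x := by
      intro w hw
      obtain ⟨hw, hwv⟩ := Finset.mem_filter.1 hw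
      obtain ⟨e, -, he⟩ := Finset.mem_biUnion.1 hw
      rcases eq_or_ne e b with rfl | heb
      · rw [Function.update_self] at he
        rcases Finset.mem_insert.1 (hsub'' he) with rfl | he
        · exact (hzv (by simpa using hwv.symm)).elim
        · obtain ⟨h1, h2⟩ := Finset.mem_erase.1 he
          exact Finset.mem_erase.2 ⟨h1, Finset.mem_filter.2 ⟨hsub e h2, hwv⟩⟩
      · rw [Function.update_of_ne heb] at he
        refine Finset.mem_erase.2 ⟨?_, Finset.mem_filter.2 ⟨hsub e he, hwv⟩⟩
        rintro rfl
        exact hF.nonadj b e heb.symm y hy w he hyx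
    have hlt := (Finset.card_le_card hss).trans_lt (Finset.card_erase_lt_of_mem
      (Finset.mem_filter.2 ⟨hsub b hx, hxv⟩))
    have hDa' : Function.update D b D' a = D₀ a := by
      rw [Function.update_of_ne (hne b x hx hxv).symm, hDa]
    exact absurd (hmin ⟨hD', hDa'⟩ hlt.le) (not_le.2 hlt)
  obtain ⟨x, hx, hxv⟩ := hdom D hD v hvJ
  obtain ⟨b, -, hxb⟩ := Finset.mem_biUnion.1 hx
  obtain ⟨y, hy, hyx, hyv⟩ := hfull b x hxb hxv
  by_cases huniq : ∀ w ∈ Finset.univ.biUnion D, G.Adj w v → w = x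
  · have hcv := (hF.exists_switch hdeg hsz hno (hdom D hD) hxb
      (Finset.mem_filter.2 ⟨Finset.mem_univ v, hvJ, hxv, huniq⟩)).1
    exact Finset.disjoint_left.1 (hF.disjoint b a (hne b x hxb hxv)) hcv hva
  · push Not at huniq
    obtain ⟨x', hx', hxv', hxx⟩ := huniq
    obtain ⟨b', -, hxb'⟩ := Finset.mem_biUnion.1 hx'
    obtain ⟨y', hy', hyx', hyv'⟩ := hfull b' x' hxb' hxv'
    have hyy : y ≠ y' := by
      rintro rfl
      exact hxx (hF.eq_of_adj (hsub b hy) hx' hx hyx' hyx)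
    have h1 := hF.lt_two_mul_card_privateNeighbors hdeg hsz (hdom D hD) (hsub b hy)
    have h2 := hF.lt_two_mul_card_privateNeighbors hdeg hsz (hdom D hD) (hsub b' hy')
    have h3 : Disjoint (privateNeighbors G c (Finset.univ.biUnion B) (Finset.univ.biUnion D) y)
        (privateNeighbors G c (Finset.univ.biUnion B) (Finset.univ.biUnion D) y') := by
      rw [Finset.disjoint_left]
      intro z hz hz'
      exact hyy ((Finset.mem_filter.1 hz').2.2.2 y (hsub b hy) (Finset.mem_filter.1 hz).2.2.1)
    have h4 := Finset.card_le_card (Finset.union_subset hyv hyv')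
    rw [Finset.card_union_of_disjoint h3] at h4
    have h5 := hdeg v
    omega

theorem exists_isIndepTransversal {V : Type*} [Fintype V] {G : SimpleGraph V} [DecidableRel G.Adj]
    {r d q k Δ : ℕ} (hd : d < r) (hr : r = q * (d + 1) + k) (hk : k ≤ d)
    (c : G.Coloring (Fin r)) (hΔ : G.maxDegree ≤ Δ)
    (hsize : ∀ i : Fin r, sizeBound r d q Δ < ((c.colorClass i).ncard : ℝ)) :
    ∃ T : Finset V, IsIndepTransversal c (r - d) T := by
  classical
  have hq : 0 < q := by
    rcases Nat.eq_zero_or_pos q with rfl | h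
    · simp at hr
      omega
    · exact h
  have hclass : ∀ K : Finset (Fin r), ((Finset.univ.filter fun v => c v ∈ K).card : ℝ) =
      ∑ i ∈ K, ((c.colorClass i).ncard : ℝ) := by
    intro K
    rw [Finset.card_eq_sum_card_fiberwise (f := c) (t := K) (by intro v; simp)]
    push_cast
    refine Finset.sum_congr rfl fun i hi => ?_
    rw [← Set.ncard_coe_finset]
    congr 2
    ext v
    simp only [Finset.coe_filter, Finset.mem_filter, Finset.mem_univ, true_and, Set.mem_ofPred_eq]
    exact ⟨fun h => h.2, fun h => ⟨h ▸ hi, h⟩⟩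
  have hlower : ∀ (K : Finset (Fin r)), K.Nonempty → ∀ s : ℝ, s ≤ sizeBound r d q Δ →
      K.card * s < ((Finset.univ.filter fun v => c v ∈ K).card : ℝ) := by
    intro K hK s hs
    rw [hclass, ← nsmul_eq_mul, ← Finset.sum_const]
    exact Finset.sum_lt_sum_of_nonempty hK fun i _ => hs.trans_lt (hsize i)
  have hr0 : (0 : ℝ) < r := by exact_mod_cast (Nat.zero_le d).trans_lt hd
  have hq0 : (0 : ℝ) < q := by exact_mod_cast hq
  obtain ⟨T, hT, hTc, hcard⟩ := exists_partial_transversal (G := G) (c := c) (Δ := Δ) (d := d)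
    (q := q)
    (fun x => by
      refine le_trans (le_of_eq ?_) ((G.degree_le_maxDegree x).trans hΔ)
      rw [← SimpleGraph.card_neighborFinset_eq_degree, SimpleGraph.neighborFinset_eq_filter])
    (fun K hK => by
      have h1 := hlower K hK _ (le_max_left _ _)
      have hKr : (K.card : ℝ) ≤ r := by exact_mod_cast K.card_le_univ.trans (by simp)
      -- Summing the bound over `K` costs the most when `K` is the set of all parts.
      have h2 : (K.card : ℝ) * ((4 * d + 5) / (4 * r)) ≤ (4 * d + 5) / 4 := by
        rw [mul_div_assoc', div_le_div_iff₀ (by positivity) (by norm_num)]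
        nlinarith [mul_le_mul_of_nonneg_right hKr (by positivity : (0 : ℝ) ≤ 4 * d + 5)]
      have h3 : (0 : ℝ) ≤ Δ := by positivity
      have h4 : (4 * Δ * K.card : ℝ) <
          2 * ((Finset.univ.filter fun v => c v ∈ K).card : ℝ) + Δ * (4 * d + 5) := by
        nlinarith [mul_le_mul_of_nonneg_left h2 h3]
      exact_mod_cast h4)
    (fun Z hZ hZq => by
      have h1 := hlower Z hZ _ (le_max_right _ _)
      have hZq' : (Z.card : ℝ) ≤ q := by exact_mod_cast hZq
      have h2 : (Z.card : ℝ) * (1 / q) ≤ 1 := by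
        rw [mul_one_div, div_le_one hq0]
        exact hZq'
      have h3 : (0 : ℝ) ≤ Δ := by positivity
      have h4 : (2 * Δ * Z.card : ℝ) <
          ((Finset.univ.filter fun v => c v ∈ Z).card : ℝ) + 2 * Δ := by
        nlinarith [mul_le_mul_of_nonneg_left h2 h3]
      exact_mod_cast h4)
    (by rw [Fintype.card_fin, add_mul]; omega)
  rw [Fintype.card_fin] at hcard
  obtain ⟨T', hT', hcard'⟩ := Finset.exists_subset_card_eq (show r - d ≤ T.card by omega)
  refine ⟨T', ?_, hTc.mono (by exact_mod_cast hT'), hcard'⟩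
  intro x hx y hy _
  exact hT x (hT' hx) y (hT' hy)

end Main

theorem theorem1p1 (r d q k Δ : ℕ) (hd : d < r) (hr : r = q * (d + 1) + k) (hk : k ≤ d) :
    (∀ (V : Type*) [Fintype V] (G : SimpleGraph V) [DecidableRel G.Adj]
        (c : G.Coloring (Fin r)), G.maxDegree ≤ Δ →
        (∀ i : Fin r, sizeBound r d q Δ < ((c.colorClass i).ncard : ℝ)) →
        ∃ T : Finset V, IsIndepTransversal c (r - d) T) ∧
      BddAbove (avoidingSizes r (d + 1) Δ) ∧
      (extremalSize r (d + 1) Δ : ℝ) ≤ sizeBound r d q Δ := by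
  have hle : ∀ n ∈ avoidingSizes r (d + 1) Δ, (n : ℝ) ≤ sizeBound r d q Δ := by
    rintro n ⟨V, _, G, _, c, hn, hΔ, hT⟩
    by_contra hlt
    refine hT ?_
    rw [Nat.add_sub_add_right]
    exact exists_isIndepTransversal hd hr hk c hΔ.le fun i =>
      (not_le.1 hlt).trans_le (by exact_mod_cast hn i)
  have hbdd : BddAbove (avoidingSizes r (d + 1) Δ) :=
    ⟨⌊sizeBound r d q Δ⌋₊, fun n hn => Nat.le_floor (hle n hn)⟩
  refine ⟨fun V _ G _ c hΔ hsize => exists_isIndepTransversal hd hr hk c hΔ hsize, hbdd, ?_⟩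
  -- For the empty set the supremum is 0, so the bound must be nonnegative; its second term is, as
  -- `q ≥ 1`.
  rcases (avoidingSizes r (d + 1) Δ).eq_empty_or_nonempty with h | h
  · have hq : (1 : ℝ) ≤ q := by
      rcases Nat.eq_zero_or_pos q with rfl | h
      · simp at hr
        omega
      · exact_mod_cast h
    have h1 : 1 / (q : ℝ) ≤ 1 := by
      rw [div_le_one (by linarith)]
      exact hq
    rw [extremalSize, h, csSup_empty, bot_eq_zero, Nat.cast_zero]
    exact le_max_of_le_right (mul_nonneg (by positivity) (by linarith))
  · exact hle _ (Nat.sSup_mem h hbdd)
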